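/- For $f=f(t,y)$ on $(0,\infty)\times(-1,1)$ write $\|f\|_{L^pL^2}=\big\|\,\|f(t)\|_{L^2(-1,1)}\big\|_{L^p(0,\infty)}$ for $p\in\{2,\infty\}$. There is an absolute constant $C>0$ such that the following holds for every $\mu>0$, every wave number $k\in\mathbb Z$, and all complex-valued $g^1,g^2\in L^2((0,\infty);L^2(-1,1))$. Let $\theta_I$ be a (weak) solution of $$\partial_t\theta_I-\mu(\partial_y^2-k^2)\theta_I+iky\,\theta_I=-ikg^1-\partial_yg^2\quad\text{in }(0,\infty)\times(-1,1),\qquad \theta_I|_{t=0}=0,\qquad \theta_I|_{y=\pm1}=0,$$ that is, $\theta_I\in L^2(0,T;H^1_0(-1,1))$ for every $T>0$, and for every $v\in H^1_0(-1,1)$ and almost every $t>0$, with $\langle f,h\rangle=\int_{-1}^1 f\,\overline{h}\,dy$, $$\langle\theta_I(t),v\rangle+\int_0^t\Big(\mu\langle\partial_y\theta_I,\partial_yv\rangle+\mu k^2\langle\theta_I,v\rangle+ik\langle y\theta_I,v\rangle\Big)ds=\int_0^t\Big(-ik\langle g^1,v\rangle+\langle g^2,\partial_yv\rangle\Big)ds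 .$$ Then $$(\mu k^2)^{1/3}\|\theta_I\|_{L^2L^2}^2+\|\theta_I\|_{L^\infty L^2}^2\le C\Big(\mu^{-1/3}|k|^{4/3}\|g^1\|_{L^2L^2}^2+\mu^{-1}\|g^2\|_{L^2L^2}^2\Big).$$ -/

import Mathlib

open MeasureTheory Set
open scoped ENNReal ComplexConjugate

noncomputable section

/-- Lebesgue measure on the interval `(-1, 1)` of the variable `y`. -/
def channelMeasure : Measure ℝ := volume.restrict (Ioo (-1) 1)

/-- Lebesgue measure on the time half-line `(0, ∞)`. -/
def timeMeasure : Measure ℝ := volume.restrict (Ioi 0)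

/-- The space-time norm `‖f‖_{L^p L^q}`: the `L^p(0, ∞)` norm in `t` of the `L^q(-1, 1)` norm
in `y` of `f t y`, with values in `[0, ∞]`. -/
def mixedNorm (p q : ℝ≥0∞) (f : ℝ → ℝ → ℂ) : ℝ≥0∞ :=
  eLpNorm (fun t => eLpNorm (f t) q channelMeasure) p timeMeasure

/-- `u ∈ H^1_0(-1, 1)` with derivative `du ∈ L^2(-1, 1)`: up to a null set, `u` is the absolutely
continuous function `y ↦ ∫_{-1}^y du`, which vanishes at `y = -1` by construction and at `y = 1`
by the last field. -/
structure IsH10 (u du : ℝ → ℂ) : Prop where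
  memLp_deriv : MemLp du 2 channelMeasure
  ae_eq_integral : ∀ᵐ y ∂channelMeasure, u y = ∫ z in (-1 : ℝ)..y, du z
  integral_eq_zero : ∫ z in (-1 : ℝ)..1, du z = 0

/-- The inner product `⟨f, h⟩ = ∫_{-1}^1 f(y) \overline{h(y)} dy` of `L^2(-1, 1)`. -/
def innerY (f h : ℝ → ℂ) : ℂ := ∫ y, f y * conj (h y) ∂channelMeasure

/-- `θ` is a weak (energy class) solution on `t > 0`, `-1 < y < 1` of
`∂_t θ - μ (∂_y^2 - k^2) θ + i k y θ = - i k g₁ - ∂_y g₂`, `θ|_{t = 0} = 0`, `θ|_{y = ± 1} = 0`: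
`θ ∈ L^2(0, T; H^1_0(-1, 1))` for every `T > 0`, and for every test function `v ∈ H^1_0(-1, 1)`
the equation paired with `v` and integrated over `(0, t)` holds for almost every `t > 0`
(there is no contribution of the time `0`, because the initial datum is zero). -/
def IsThetaISolution (μ : ℝ) (k : ℤ) (g₁ g₂ θ : ℝ → ℝ → ℂ) : Prop :=
  ∃ dθ : ℝ → ℝ → ℂ,
    (∀ T : ℝ, 0 < T →
      MemLp (Function.uncurry θ) 2 ((volume.restrict (Ioo 0 T)).prod channelMeasure) ∧
      MemLp (Function.uncurry dθ) 2 ((volume.restrict (Ioo 0 T)).prod channelMeasure)) ∧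
    (∀ᵐ t ∂timeMeasure, IsH10 (θ t) (dθ t)) ∧
    ∀ v dv : ℝ → ℂ, IsH10 v dv →
      ∀ᵐ t ∂timeMeasure,
        innerY (θ t) v
          + ∫ s in (0 : ℝ)..t,
              ((μ : ℂ) * innerY (dθ s) dv + (μ : ℂ) * (k : ℂ) ^ 2 * innerY (θ s) v
                + Complex.I * (k : ℂ) * innerY (fun y => (y : ℂ) * θ s y) v)
        = ∫ s in (0 : ℝ)..t,
              (-(Complex.I * (k : ℂ) * innerY (g₁ s) v) + innerY (g₂ s) dv)

end

/-! Let `τ = (μ k²)^(-1/3)`, the time on which shear and diffusion balance. For `k ≠ 0` the claim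
combines an energy inequality with a bound of `τ⁻¹ ∫ ‖θ‖²` by the dissipation and the data.

The energy inequality is the usual one: the shear term is skew and drops out, and Young's inequality
treats the sources. A weak solution has no time derivative to pair with `θ`, so
`IsWeakEvolution.energy_le` tests the increment `θ(t) - θ(t - h)` with `θ(t)`, integrates in `t`,
and lets `h → 0`. Only an inequality is needed.

The enhanced dissipation comes from oscillation. Fix `t` and test the equation on `(t - τ, t)` with
`φ(s) = exp(-i k (s - t) y) θ(t)`, which is transported by the shear flow, so the shear term
cancels. The pairing of `φ(t)` with `θ(t)` is `‖θ(t)‖²`. At the other endpoint the factor `exp(i k τ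
y)` oscillates, and one integration by parts in `y`, without boundary terms by the Dirichlet
condition, gains `(|k| τ)⁻¹` at the price of one derivative (`IsWeakEvolution.ae_norm_sq_le`). Since
`(|k| τ)² = (μ τ)⁻¹`, integrating in `t` gives `∫ ‖θ‖² ≲ τ (μ ∫ ‖∂θ‖² + …)`
(`IsShearEvolution.integral_norm_sq_le`), and the energy inequality closes the estimate
(`IsShearEvolution.estimate`). For `k = 0` the energy inequality alone suffices.

The argument runs in a Hilbert space `E` with a closed subspace `V` of `E × E`, the graph of the
derivative, and a bounded self-adjoint `Y`. Only the product rule for `Y` and integration by parts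
on `V` are used; both are then verified for `H^1_0(-1, 1)` and multiplication by `y`. -/

noncomputable section

/-! ### Integration by parts for primitives. -/

section BilinearParts

variable {E F G : Type*} [NormedAddCommGroup E] [NormedSpace ℝ E] [CompleteSpace E]
  [NormedAddCommGroup F] [NormedSpace ℝ F] [CompleteSpace F]
  [NormedAddCommGroup G] [NormedSpace ℝ G] [CompleteSpace G]

/-- Integration by parts for primitives of integrable functions and a continuous bilinear map. -/
theorem intervalIntegral_bilin_primitive (B : E →L[ℝ] F →L[ℝ] G) {f : ℝ → E} {g : ℝ → F}
    {a b : ℝ} (hab : a ≤ b) (hf : IntervalIntegrable f volume a b)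
    (hg : IntervalIntegrable g volume a b) :
    ∫ s in a..b, (B (f s) (∫ r in a..s, g r) + B (∫ r in a..s, f r) (g s))
      = B (∫ s in a..b, f s) (∫ s in a..b, g s) := by
  set ν : Measure ℝ := volume.restrict (Ioc a b) with hν
  have hf' : Integrable f ν := (intervalIntegrable_iff_integrableOn_Ioc_of_le hab).1 hf
  have hg' : Integrable g ν := (intervalIntegrable_iff_integrableOn_Ioc_of_le hab).1 hg
  have hΦ : Integrable (fun p : ℝ × ℝ => B (f p.1) (g p.2)) (ν.prod ν) := by
    refine Integrable.mono' (g := fun p : ℝ × ℝ => ‖B‖ * (‖f p.1‖ * ‖g p.2‖))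
      ((hf'.norm.mul_prod hg'.norm).const_mul _) ?_ ?_
    · exact B.aestronglyMeasurable_comp₂ hf'.aestronglyMeasurable.comp_fst
        hg'.aestronglyMeasurable.comp_snd
    · filter_upwards with p
      simpa [mul_assoc] using B.le_opNorm₂ (f p.1) (g p.2)
  -- By Fubini the two terms are integrals of `B (f s) (g r)` over complementary triangles of the
  -- square.
  set S : Set (ℝ × ℝ) := {p | p.2 ≤ p.1} with hS
  have hSm : MeasurableSet S := measurableSet_le measurable_snd measurable_fst
  have h1 : ∫ s, B (f s) (∫ r in a..s, g r) ∂ν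
      = ∫ p in S, B (f p.1) (g p.2) ∂(ν.prod ν) := by
    rw [← integral_indicator hSm, integral_prod _ (hΦ.indicator hSm)]
    refine setIntegral_congr_fun measurableSet_Ioc fun s hs => ?_
    have : (fun r => S.indicator (fun p : ℝ × ℝ => B (f p.1) (g p.2)) (s, r))
        = fun r => B (f s) ((Iic s).indicator g r) := by
      funext r
      by_cases h : r ≤ s <;> simp [hS, h]
    simp only [this]
    rw [ContinuousLinearMap.integral_comp_comm _ (hg'.indicator measurableSet_Iic),
      integral_indicator measurableSet_Iic, hν, Measure.restrict_restrict measurableSet_Iic,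
      intervalIntegral.integral_of_le hs.1.le]
    congr 4
    ext r; simp only [mem_Ioc, mem_inter_iff, mem_Iic]
    exact ⟨fun h => ⟨h.2, h.1, h.2.trans hs.2⟩, fun h => ⟨h.2.1, h.1⟩⟩
  have h2 : ∫ s, B (∫ r in a..s, f r) (g s) ∂ν
      = ∫ p in Sᶜ, B (f p.1) (g p.2) ∂(ν.prod ν) := by
    rw [← integral_indicator hSm.compl, integral_prod_symm _ (hΦ.indicator hSm.compl)]
    refine setIntegral_congr_fun measurableSet_Ioc fun s hs => ?_
    have : (fun r => Sᶜ.indicator (fun p : ℝ × ℝ => B (f p.1) (g p.2)) (r, s))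
        = fun r => B.flip (g s) ((Iio s).indicator f r) := by
      funext r
      by_cases h : r < s
      · simp [hS, h]
      · simp [hS, h, not_lt.1 h]
    simp only [this]
    rw [ContinuousLinearMap.integral_comp_comm _ (hf'.indicator measurableSet_Iio),
      integral_indicator measurableSet_Iio, hν, Measure.restrict_restrict measurableSet_Iio,
      intervalIntegral.integral_of_le hs.1.le, integral_Ioc_eq_integral_Ioo,
      ContinuousLinearMap.flip_apply]
    congr 4
    ext r; simp only [mem_Ioo, mem_Ioc, mem_inter_iff, mem_Iio]
    exact ⟨fun h => ⟨h.2, h.1, h.2.le.trans hs.2⟩, fun h => ⟨h.2.1, h.1⟩⟩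
  have hcF : ContinuousOn (fun s => ∫ r in a..s, f r) (uIcc a b) :=
    intervalIntegral.continuousOn_primitive_interval
      ((intervalIntegrable_iff' (by simp)).1 hf)
  have hcG : ContinuousOn (fun s => ∫ r in a..s, g r) (uIcc a b) :=
    intervalIntegral.continuousOn_primitive_interval
      ((intervalIntegrable_iff' (by simp)).1 hg)
  have hi1 : Integrable (fun s => B (f s) (∫ r in a..s, g r)) ν := by
    obtain ⟨C, hC⟩ := isCompact_uIcc.exists_bound_of_continuousOn hcG
    refine B.integrable_of_bilin_of_bdd_right C hf' ?_ ?_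
    · refine (hcG.mono ?_).aestronglyMeasurable measurableSet_Ioc
      rw [uIcc_of_le hab]; exact Ioc_subset_Icc_self
    · filter_upwards [ae_restrict_mem measurableSet_Ioc] with s hs
      exact hC s (by rw [uIcc_of_le hab]; exact Ioc_subset_Icc_self hs)
  have hi2 : Integrable (fun s => B (∫ r in a..s, f r) (g s)) ν := by
    obtain ⟨C, hC⟩ := isCompact_uIcc.exists_bound_of_continuousOn hcF
    refine B.integrable_of_bilin_of_bdd_left C ?_ ?_ hg'
    · refine (hcF.mono ?_).aestronglyMeasurable measurableSet_Ioc
      rw [uIcc_of_le hab]; exact Ioc_subset_Icc_self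
    · filter_upwards [ae_restrict_mem measurableSet_Ioc] with s hs
      exact hC s (by rw [uIcc_of_le hab]; exact Ioc_subset_Icc_self hs)
  rw [intervalIntegral.integral_of_le hab, integral_add hi1 hi2, h1, h2,
    integral_add_compl hSm hΦ, integral_prod _ hΦ, intervalIntegral.integral_of_le hab,
    intervalIntegral.integral_of_le hab, ← hν]
  have : ∀ s, ∫ r, B (f s) (g r) ∂ν = B.flip (∫ r, g r ∂ν) (f s) := fun s => by
    rw [ContinuousLinearMap.integral_comp_comm _ hg', ContinuousLinearMap.flip_apply]
  simp only [this]
  rw [ContinuousLinearMap.integral_comp_comm _ hf', ContinuousLinearMap.flip_apply]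

end BilinearParts

/-! ### The modulation group `exp (-i κ s Y)` acting on the form domain. -/

section ModulationGroup

variable {E : Type*} [NormedAddCommGroup E] [InnerProductSpace ℂ E] [CompleteSpace E]

theorem exp_smul_mem_of_invariant {W : Type*} [NormedAddCommGroup W] [NormedSpace ℂ W]
    [CompleteSpace W] {V : Submodule ℂ W} (hV : IsClosed (V : Set W)) {T : W →L[ℂ] W}
    (hT : ∀ p ∈ V, T p ∈ V) (s : ℝ) {p : W} (hp : p ∈ V) :
    NormedSpace.exp (s • T) p ∈ V := by
  have hpow : ∀ n : ℕ, (T ^ n) p ∈ V := fun n => by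
    induction n with
    | zero => simpa using hp
    | succ n ih => rw [pow_succ']; exact hT _ ih
  have hs := (NormedSpace.exp_series_hasSum_exp' (𝕂 := ℂ) (s • T)).mapL
    (ContinuousLinearMap.apply ℂ W p)
  refine hV.mem_of_tendsto hs (Filter.Eventually.of_forall fun A => V.sum_mem fun n _ => ?_)
  have : (s • T) ^ n = ((s : ℂ) ^ n) • T ^ n := by
    rw [← smul_pow]; congr 1
  simp only [ContinuousLinearMap.apply_apply, this, _root_.smul_apply]
  exact V.smul_mem _ (V.smul_mem _ (hpow n))

/-- By uniqueness for linear equations the curve is `exp (s T) (φ 0)`, and the partial sums of the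
exponential series stay in the closed subspace. This keeps modulated test vectors in the form
domain. -/
theorem mem_of_hasDerivAt_of_invariant {W : Type*} [NormedAddCommGroup W] [NormedSpace ℂ W]
    [CompleteSpace W] {V : Submodule ℂ W} (hV : IsClosed (V : Set W)) {T : W →L[ℂ] W}
    (hT : ∀ p ∈ V, T p ∈ V) {φ : ℝ → W} (hφ : ∀ s, HasDerivAt φ (T (φ s)) s) (h0 : φ 0 ∈ V)
    (s : ℝ) : φ s ∈ V := by
  have key : φ = fun s => NormedSpace.exp (s • T) (φ 0) := by
    refine ODE_solution_unique_univ (v := fun _ => T) (s := fun _ => univ) (t₀ := 0)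
      (K := ‖T‖₊) (fun _ => T.lipschitz.lipschitzOnWith)
      (fun t => ⟨hφ t, mem_univ _⟩) (fun t => ⟨?_, mem_univ _⟩) ?_
    · have h := hasDerivAt_exp_smul_const' (𝕂 := ℝ) T t
      exact ((ContinuousLinearMap.apply ℂ W (φ 0)).restrictScalars ℝ).hasFDerivAt.comp_hasDerivAt
        t h
    · simp
  rw [key]
  exact exp_smul_mem_of_invariant hV hT s h0

/-- The unitary group `exp (-i κ s Y)` generated by a bounded operator `Y`. -/
def modulation (Y : E →L[ℂ] E) (κ s : ℝ) : E →L[ℂ] E :=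
  NormedSpace.exp (s • ((-(Complex.I * κ)) • Y))

theorem modulation_zero (Y : E →L[ℂ] E) (κ : ℝ) : modulation Y κ 0 = 1 := by
  simp [modulation]

theorem norm_modulation {Y : E →L[ℂ] E} (hY : IsSelfAdjoint Y) (κ s : ℝ) (u : E) :
    ‖modulation Y κ s u‖ = ‖u‖ := by
  apply ContinuousLinearMap.norm_map_of_mem_unitary
  let := NormedAlgebra.restrictScalars ℚ ℂ (E →L[ℂ] E)
  apply NormedSpace.exp_mem_unitary_of_mem_skewAdjoint
  rw [skewAdjoint.mem_iff, star_smul, star_smul, hY.star_eq]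
  simp

theorem hasDerivAt_modulation (Y : E →L[ℂ] E) (κ s : ℝ) (u : E) :
    HasDerivAt (fun s => modulation Y κ s u) ((-(Complex.I * κ)) • Y (modulation Y κ s u)) s := by
  have h := hasDerivAt_exp_smul_const' (𝕂 := ℝ) ((-(Complex.I * κ)) • Y) s
  exact ((ContinuousLinearMap.apply ℂ E u).restrictScalars ℝ).hasFDerivAt.comp_hasDerivAt s h

/-- The lift of `modulation` to pairs `(u, ∂u)`. -/
def modulationPair (Y : E →L[ℂ] E) (κ s : ℝ) (p : E × E) : E × E :=
  (modulation Y κ s p.1, modulation Y κ s (p.2 - (s * (Complex.I * κ)) • p.1))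

/-- The generator of `modulationPair`. -/
def modulationGenerator (Y : E →L[ℂ] E) (κ : ℝ) : E × E →L[ℂ] E × E :=
  (-(Complex.I * κ)) • ((Y ∘L ContinuousLinearMap.fst ℂ E E).prod
    (ContinuousLinearMap.fst ℂ E E + Y ∘L ContinuousLinearMap.snd ℂ E E))

/-- The second component encodes `∂(exp(-iκsy) u) = exp(-iκsy) (∂u - iκs u)`. On pairs the explicit
factor `s` is absorbed, so the equation becomes autonomous with a bounded generator. -/
theorem hasDerivAt_modulationPair (Y : E →L[ℂ] E) (κ s : ℝ) (p : E × E) :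
    HasDerivAt (fun s => modulationPair Y κ s p)
      (modulationGenerator Y κ (modulationPair Y κ s p)) s := by
  have h1 := hasDerivAt_modulation Y κ s p.1
  have h2 := hasDerivAt_modulation Y κ s p.2
  have h3 : HasDerivAt (fun s : ℝ => (s : ℂ) * (Complex.I * κ)) (Complex.I * κ) s := by
    simpa using (Complex.ofRealCLM.hasDerivAt (x := s)).mul_const (Complex.I * (κ : ℂ))
  have h4 := h2.sub (h3.smul h1)
  have h5 := h1.prodMk h4
  convert! h5 using 1
  · funext s
    simp [modulationPair]
  · simp only [modulationGenerator, modulationPair, map_sub, map_smul]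
    ext
    · simp
    · simp [smul_sub, smul_add, smul_smul]
      module

theorem modulationPair_mem {V : Submodule ℂ (E × E)} (hV : IsClosed (V : Set (E × E)))
    {Y : E →L[ℂ] E} (hYV : ∀ p ∈ V, (Y p.1, p.1 + Y p.2) ∈ V) (κ s : ℝ) {p : E × E}
    (hp : p ∈ V) : modulationPair Y κ s p ∈ V := by
  refine mem_of_hasDerivAt_of_invariant hV (T := modulationGenerator Y κ)
    (fun p hp => V.smul_mem _ (hYV p hp)) (fun s => hasDerivAt_modulationPair Y κ s p) ?_ s
  simpa [modulationPair, modulation_zero] using hp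

end ModulationGroup

/-! ### Weak solutions in a Hilbert space. -/

section WeakEvolution

open Filter Topology

variable {E : Type*} [NormedAddCommGroup E] [InnerProductSpace ℂ E] [CompleteSpace E]

/-- `θ` starts from `0` at time `0`, `(θ, dθ)` takes values in the form domain `V`, and
`∂ₜ θ` is the functional `(v, dv) ↦ ⟪v, a⟫ + ⟪dv, b⟫` on `V`, in the sense of weak solutions. -/
structure IsWeakEvolution (V : Submodule ℂ (E × E)) (θ dθ a b : ℝ → E) : Prop where
  memLp_sol : ∀ T, MemLp θ 2 (volume.restrict (Iio T))
  memLp_deriv : ∀ T, MemLp dθ 2 (volume.restrict (Iio T))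
  memLp_left : ∀ T, MemLp a 2 (volume.restrict (Iio T))
  memLp_right : ∀ T, MemLp b 2 (volume.restrict (Iio T))
  sol_eq_zero : ∀ t ≤ 0, θ t = 0
  left_eq_zero : ∀ t ≤ 0, a t = 0
  right_eq_zero : ∀ t ≤ 0, b t = 0
  mem : ∀ᵐ t, (θ t, dθ t) ∈ V
  weak : ∀ p ∈ V, ∀ᵐ t : ℝ, 0 < t →
    inner ℂ p.1 (θ t) = ∫ s in (0 : ℝ)..t, (inner ℂ p.1 (a s) + inner ℂ p.2 (b s))

theorem intervalIntegrable_of_memLp_Iio {F : Type*} [NormedAddCommGroup F] {f : ℝ → F}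
    (hf : ∀ T, MemLp f 2 (volume.restrict (Iio T))) (x y : ℝ) :
    IntervalIntegrable f volume x y := by
  rw [intervalIntegrable_iff]
  have h : MemLp f 2 (volume.restrict (uIoc x y)) := by
    refine (hf (max x y + 1)).mono_measure (Measure.restrict_mono ?_ le_rfl)
    intro z hz
    have := (mem_uIoc.1 hz)
    simp only [mem_Iio]
    rcases this with h | h
    · linarith [h.2, le_max_right x y]
    · linarith [h.2, le_max_left x y]
  have : IsFiniteMeasure (volume.restrict (uIoc x y)) := by rw [uIoc]; infer_instance
  exact h.integrable (by norm_num)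

theorem aestronglyMeasurable_of_memLp_Iio {F : Type*} [NormedAddCommGroup F] {f : ℝ → F}
    (hf : ∀ T, MemLp f 2 (volume.restrict (Iio T))) : AEStronglyMeasurable f volume := by
  have h := aestronglyMeasurable_iUnion_iff.2 fun n : ℕ => (hf n).aestronglyMeasurable
  have hu : (⋃ n : ℕ, Iio (n : ℝ)) = univ := by
    refine eq_univ_of_forall fun x => ?_
    obtain ⟨n, hn⟩ := exists_nat_gt x
    exact mem_iUnion.2 ⟨n, hn⟩
  rwa [hu, Measure.restrict_univ] at h

theorem intervalIntegral_eq_zero_of_nonpos {F : Type*} [NormedAddCommGroup F] [NormedSpace ℝ F]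
    {f : ℝ → F} (hf : ∀ t ≤ 0, f t = 0) {t : ℝ} (ht : t ≤ 0) : ∫ s in (0 : ℝ)..t, f s = 0 := by
  rw [intervalIntegral.integral_congr (g := fun _ => 0)]
  · simp
  · intro s hs
    rw [uIcc_of_ge ht] at hs
    exact hf s hs.2

/-- The exceptional null set in the weak formulation can be chosen uniformly in the test vector. -/
theorem IsWeakEvolution.ae_forall [SecondCountableTopology E] {V : Submodule ℂ (E × E)}
    {θ dθ a b : ℝ → E} (h : IsWeakEvolution V θ dθ a b) :
    ∀ᵐ t : ℝ, ∀ p ∈ V, inner ℂ p.1 (θ t)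
      = inner ℂ p.1 (∫ s in (0 : ℝ)..t, a s) + inner ℂ p.2 (∫ s in (0 : ℝ)..t, b s) := by
  -- A countable dense set of test vectors suffices, since both sides are continuous in the test
  -- vector. Test vectors built from `θ t` itself thereby become admissible at time `t`.
  have hd := TopologicalSpace.denseRange_denseSeq V
  have hae : ∀ᵐ t : ℝ, ∀ n, 0 < t → inner ℂ (TopologicalSpace.denseSeq V n).1.1 (θ t)
      = ∫ s in (0 : ℝ)..t, (inner ℂ (TopologicalSpace.denseSeq V n).1.1 (a s)
        + inner ℂ (TopologicalSpace.denseSeq V n).1.2 (b s)) :=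
    ae_all_iff.2 fun n => h.weak _ (TopologicalSpace.denseSeq V n).2
  filter_upwards [hae] with t ht
  rcases le_or_gt t 0 with h0 | h0
  · intro p _
    rw [h.sol_eq_zero t h0, intervalIntegral_eq_zero_of_nonpos h.left_eq_zero h0,
      intervalIntegral_eq_zero_of_nonpos h.right_eq_zero h0]
    simp
  have ia := intervalIntegrable_of_memLp_Iio h.memLp_left 0 t
  have ib := intervalIntegrable_of_memLp_Iio h.memLp_right 0 t
  have key : ∀ p : V, inner ℂ p.1.1 (θ t)
      = inner ℂ p.1.1 (∫ s in (0 : ℝ)..t, a s) + inner ℂ p.1.2 (∫ s in (0 : ℝ)..t, b s) := by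
    refine fun p => hd.induction_on (p := fun p : V => inner ℂ p.1.1 (θ t)
      = inner ℂ p.1.1 (∫ s in (0 : ℝ)..t, a s) + inner ℂ p.1.2 (∫ s in (0 : ℝ)..t, b s)) p
      ?_ fun n => ?_
    · exact isClosed_eq (by fun_prop) (by fun_prop)
    · rw [ht n h0, intervalIntegral.integral_add]
      · congr 1
        · exact ((innerSL ℂ _).intervalIntegral_comp_comm ia)
        · exact ((innerSL ℂ _).intervalIntegral_comp_comm ib)
      · exact ⟨(innerSL ℂ _).integrable_comp ia.1, (innerSL ℂ _).integrable_comp ia.2⟩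
      · exact ⟨(innerSL ℂ _).integrable_comp ib.1, (innerSL ℂ _).integrable_comp ib.2⟩
  exact fun p hp => key ⟨p, hp⟩

theorem ae_translate {p : ℝ → Prop} (hp : ∀ᵐ t, p t) (h : ℝ) : ∀ᵐ t, p (t - h) :=
  (measurePreserving_sub_right volume h).quasiMeasurePreserving.ae hp

-- Translations act strongly continuously on `L²`. This permits differentiating averaged
-- correlations at zero lag in the energy inequality.
omit [CompleteSpace E] in
theorem continuous_integral_inner_translate {f g : ℝ → E} (hf : MemLp f 2 volume)
    (hg : MemLp g 2 volume) : Continuous fun r => ∫ t, inner ℂ (f t) (g (t - r)) := by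
  have hc : Continuous fun r : ℝ => (Lp.compMeasurePreserving (fun t : ℝ => t - r)
      (measurePreserving_sub_right volume r) (hg.toLp g) : Lp E 2 (volume : Measure ℝ)) := by
    let G : C(ℝ, C(ℝ, ℝ)) := (ContinuousMap.mk (fun a : ℝ × ℝ ↦ a.2 - a.1) (by fun_prop)).curry
    exact Continuous.compMeasurePreservingLp (g := G) continuous_const G.continuous
      (fun r => measurePreserving_sub_right volume r) (by norm_num)
  have h2 : Continuous fun r : ℝ => inner ℂ (hf.toLp f) (Lp.compMeasurePreserving
      (fun t : ℝ => t - r) (measurePreserving_sub_right volume r) (hg.toLp g)) :=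
    continuous_const.inner hc
  convert h2 using 2 with r
  rw [L2.inner_def]
  refine integral_congr_ae ?_
  filter_upwards [hf.coeFn_toLp, Lp.coeFn_compMeasurePreserving (hg.toLp g)
    (measurePreserving_sub_right volume r), ae_translate hg.coeFn_toLp r] with t h1 h2 h3
  rw [h1, h2, Function.comp, h3]

end WeakEvolution

/-! ### Time translates and averages over time windows. -/

section Translates

open Filter Topology

variable {E : Type*} [NormedAddCommGroup E] [InnerProductSpace ℂ E]

theorem integrable_translate_prod {F : Type*} [NormedAddCommGroup F] {q : ℝ → F}
    (hq : Integrable q volume) (h : ℝ) :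
    Integrable (fun p : ℝ × ℝ => q (p.1 - p.2)) (volume.prod (volume.restrict (Ioc 0 h))) := by
  have hm : AEStronglyMeasurable (fun p : ℝ × ℝ => q (p.1 - p.2))
      (volume.prod (volume.restrict (Ioc 0 h))) := by
    have := hq.aestronglyMeasurable.comp_quasiMeasurePreserving
      (quasiMeasurePreserving_sub (volume : Measure ℝ) (volume : Measure ℝ))
    refine this.mono_measure ?_
    exact Measure.prod_mono le_rfl Measure.restrict_le_self
  refine (integrable_prod_iff' hm).2 ⟨.of_forall fun r => hq.comp_sub_right r, ?_⟩
  have : (fun r : ℝ => ∫ t : ℝ, ‖q (t - r)‖) = fun _ => ∫ t, ‖q t‖ := by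
    funext r
    exact integral_sub_right_eq_self (fun t => ‖q t‖) r
  simp only [this]
  exact integrable_const _

theorem integrable_norm_sq_of_memLp {F : Type*} [NormedAddCommGroup F] {f : ℝ → F}
    {μ : Measure ℝ} (hf : MemLp f 2 μ) : Integrable (fun t => ‖f t‖ ^ 2) μ :=
  hf.norm.integrable_sq

theorem integrable_inner_of_memLp {α : Type*} {m : MeasurableSpace α} {μ : Measure α}
    {f g : α → E} (hf : MemLp f 2 μ) (hg : MemLp g 2 μ) :
    Integrable (fun t => inner ℂ (f t) (g t)) μ := by
  refine (L2.integrable_inner (𝕜 := ℂ) (hf.toLp f) (hg.toLp g)).congr ?_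
  filter_upwards [hf.coeFn_toLp, hg.coeFn_toLp] with t h1 h2
  rw [h1, h2]

/-- The product is dominated by the sum of the two squares. Lags `r > 0` keep `t - r` below `T`,
where `g` is square integrable. -/
theorem integrable_inner_translate_prod {f g : ℝ → E}
    (hf : ∀ T, MemLp f 2 (volume.restrict (Iio T)))
    (hg : ∀ T, MemLp g 2 (volume.restrict (Iio T))) (T h : ℝ) :
    Integrable (fun p : ℝ × ℝ => inner ℂ (f p.1) (g (p.1 - p.2)))
      ((volume.restrict (Iio T)).prod (volume.restrict (Ioc 0 h))) := by
  have hle : (volume.restrict (Iio T)).prod (volume.restrict (Ioc (0 : ℝ) h))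
      ≤ (volume : Measure ℝ).prod (volume.restrict (Ioc 0 h)) :=
    Measure.prod_mono Measure.restrict_le_self le_rfl
  have h1 : Integrable (fun p : ℝ × ℝ => ‖f p.1‖ ^ 2)
      ((volume.restrict (Iio T)).prod (volume.restrict (Ioc 0 h))) :=
    (integrable_norm_sq_of_memLp (hf T)).comp_fst _
  have h2 : Integrable (fun p : ℝ × ℝ => (Iio T).indicator (fun t => ‖g t‖ ^ 2) (p.1 - p.2))
      ((volume.restrict (Iio T)).prod (volume.restrict (Ioc 0 h))) :=
    (integrable_translate_prod ((integrable_indicator_iff measurableSet_Iio).2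
      (integrable_norm_sq_of_memLp (hg T))) h).mono_measure hle
  refine Integrable.mono' (h1.add h2) ?_ ?_
  · refine AEStronglyMeasurable.inner ?_ ?_
    · exact (hf T).aestronglyMeasurable.comp_fst
    · have := (aestronglyMeasurable_of_memLp_Iio hg).comp_quasiMeasurePreserving
        (quasiMeasurePreserving_sub (volume : Measure ℝ) (volume : Measure ℝ))
      exact this.mono_measure (hle.trans (Measure.prod_mono le_rfl Measure.restrict_le_self))
  · rw [Measure.prod_restrict]
    filter_upwards [ae_restrict_mem (measurableSet_Iio.prod measurableSet_Ioc)] with p hp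
    have hlt : p.1 - p.2 < T := by
      have h1 : p.1 < T := hp.1
      have h2 : 0 < p.2 := hp.2.1
      linarith
    have hi := norm_inner_le_norm (𝕜 := ℂ) (f p.1) (g (p.1 - p.2))
    simp only [Pi.add_apply, indicator_of_mem (show p.1 - p.2 ∈ Iio T from hlt)]
    nlinarith [sq_nonneg (‖f p.1‖ - ‖g (p.1 - p.2)‖), norm_nonneg (f p.1),
      norm_nonneg (g (p.1 - p.2))]

/-- With `s = t - r` and Fubini, each lag `r` in `(0, h]` contributes at most the full integral of
`q`. -/
theorem setIntegral_translate_le {q : ℝ → ℝ} {T h : ℝ} (h0 : 0 ≤ h) (hq0 : ∀ t, 0 ≤ q t)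
    (hq : IntegrableOn q (Iio T)) :
    IntegrableOn (fun t => ∫ s in (t - h)..t, q s) (Iio T) ∧
      ∫ t in Iio T, ∫ s in (t - h)..t, q s ≤ h * ∫ t in Iio T, q t := by
  set Q := (Iio T).indicator q with hQ
  have hQi : Integrable Q := (integrable_indicator_iff measurableSet_Iio).2 hq
  have hQ0 : ∀ t, 0 ≤ Q t := fun t => indicator_nonneg (fun t _ => hq0 t) t
  have hp := integrable_translate_prod hQi h
  have heq : EqOn (fun t => ∫ s in (t - h)..t, q s)
      (fun t => ∫ r in Ioc 0 h, Q (t - r)) (Iio T) := by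
    intro t ht
    simp only
    rw [← intervalIntegral.integral_of_le h0, intervalIntegral.integral_comp_sub_left, sub_zero]
    refine intervalIntegral.integral_congr fun s hs => ?_
    rw [uIcc_of_le (by linarith)] at hs
    rw [hQ, indicator_of_mem (show s ∈ Iio T from lt_of_le_of_lt hs.2 ht)]
  have hint := hp.integral_prod_left
  refine ⟨(hint.integrableOn (s := Iio T)).congr_fun (fun t ht => (heq ht).symm)
    measurableSet_Iio, ?_⟩
  rw [setIntegral_congr_fun measurableSet_Iio heq]
  calc ∫ t in Iio T, ∫ r in Ioc 0 h, Q (t - r)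
      ≤ ∫ t, ∫ r in Ioc 0 h, Q (t - r) :=
        setIntegral_le_integral hint (.of_forall fun t => integral_nonneg fun r => hQ0 _)
    _ = ∫ r in Ioc 0 h, ∫ t, Q (t - r) := integral_integral_swap hp
    _ = h * ∫ t in Iio T, q t := by
        simp only [integral_sub_right_eq_self Q]
        rw [setIntegral_const, hQ, integral_indicator measurableSet_Iio]
        simp [h0]

/-- Averaging the pairing of `f t` with the values of `g` on a time window before `t`. -/
theorem setIntegral_inner_window [CompleteSpace E] {f g : ℝ → E}
    (hf : ∀ T, MemLp f 2 (volume.restrict (Iio T)))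
    (hg : ∀ T, MemLp g 2 (volume.restrict (Iio T))) (T : ℝ) {h : ℝ} (h0 : 0 ≤ h) :
    IntegrableOn (fun t => inner ℂ (f t) (∫ s in (t - h)..t, g s)) (Iio T) ∧
      ∫ t in Iio T, inner ℂ (f t) (∫ s in (t - h)..t, g s)
        = ∫ r in (0 : ℝ)..h, ∫ t in Iio T, inner ℂ (f t) (g (t - r)) := by
  have hp := integrable_inner_translate_prod hf hg T h
  have heq : (fun t => inner ℂ (f t) (∫ s in (t - h)..t, g s))
      = fun t => ∫ r in Ioc 0 h, inner ℂ (f t) (g (t - r)) := by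
    funext t
    rw [← intervalIntegral.integral_of_le h0,
      intervalIntegral.integral_comp_sub_left (fun s => inner ℂ (f t) (g s)), sub_zero]
    exact ((innerSL ℂ (f t)).intervalIntegral_comp_comm
      (intervalIntegrable_of_memLp_Iio hg _ _)).symm
  rw [heq]
  refine ⟨hp.integral_prod_left, ?_⟩
  rw [intervalIntegral.integral_of_le h0]
  exact integral_integral_swap hp

/-- Both functions are cut off at `T` to make them globally square integrable. The cutoff of `g (t -
r)` is harmless exactly for nonnegative lags. -/
theorem exists_continuous_setIntegral_inner_translate {f g : ℝ → E}
    (hf : ∀ T, MemLp f 2 (volume.restrict (Iio T)))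
    (hg : ∀ T, MemLp g 2 (volume.restrict (Iio T))) (T : ℝ) :
    ∃ c : ℝ → ℂ, Continuous c ∧
      ∀ r, 0 ≤ r → c r = ∫ t in Iio T, inner ℂ (f t) (g (t - r)) := by
  have hf' := (memLp_indicator_iff_restrict measurableSet_Iio).2 (hf T)
  have hg' := (memLp_indicator_iff_restrict measurableSet_Iio).2 (hg T)
  refine ⟨_, continuous_integral_inner_translate hf' hg', fun r hr => ?_⟩
  rw [← integral_indicator measurableSet_Iio]
  congr 1
  funext t
  by_cases ht : t < T
  · have : t - r < T := by linarith
    simp [ht, this]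
  · simp [ht]

end Translates

/-! ### The energy inequality. -/

section Energy

open Filter Topology

variable {E : Type*} [NormedAddCommGroup E] [InnerProductSpace ℂ E] [CompleteSpace E]
  [SecondCountableTopology E]

theorem IsWeakEvolution.ae_increment {V : Submodule ℂ (E × E)} {θ dθ a b : ℝ → E}
    (H : IsWeakEvolution V θ dθ a b) (h : ℝ) : ∀ᵐ t : ℝ, ∀ p ∈ V,
      inner ℂ p.1 (θ t - θ (t - h))
        = inner ℂ p.1 (∫ s in (t - h)..t, a s) + inner ℂ p.2 (∫ s in (t - h)..t, b s) := by
  have ia := intervalIntegrable_of_memLp_Iio H.memLp_left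
  have ib := intervalIntegrable_of_memLp_Iio H.memLp_right
  filter_upwards [H.ae_forall, ae_translate H.ae_forall h] with t h1 h2 p hp
  rw [inner_sub_right, h1 p hp, h2 p hp,
    ← intervalIntegral.integral_interval_sub_left (ia 0 t) (ia 0 (t - h)),
    ← intervalIntegral.integral_interval_sub_left (ib 0 t) (ib 0 (t - h)),
    inner_sub_right, inner_sub_right]
  ring

/-- Rests on `‖x‖² - ‖y‖² = 2 Re ⟪x, x - y⟫ - ‖x - y‖²` with `x = θ t` and `y = θ (t - h)`: the last
term has a favourable sign, and the pairing is the increment equation tested with `(θ t, dθ t)`. -/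
theorem IsWeakEvolution.window_energy_le {V : Submodule ℂ (E × E)} {θ dθ a b : ℝ → E}
    (H : IsWeakEvolution V θ dθ a b) (T : ℝ) {h : ℝ} (h0 : 0 ≤ h) :
    ∫ t in (T - h)..T, ‖θ t‖ ^ 2 ≤ 2 * (∫ r in (0 : ℝ)..h,
      ((∫ t in Iio T, inner ℂ (θ t) (a (t - r)))
        + ∫ t in Iio T, inner ℂ (dθ t) (b (t - r)))).re := by
  obtain ⟨i1, e1⟩ := setIntegral_inner_window H.memLp_sol H.memLp_left T h0
  obtain ⟨i2, e2⟩ := setIntegral_inner_window H.memLp_deriv H.memLp_right T h0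
  obtain ⟨c1, hc1, hc1'⟩ := exists_continuous_setIntegral_inner_translate H.memLp_sol H.memLp_left T
  obtain ⟨c2, hc2, hc2'⟩ :=
    exists_continuous_setIntegral_inner_translate H.memLp_deriv H.memLp_right T
  have hii : ∀ {c : ℝ → ℂ} {F : ℝ → ℂ}, Continuous c → (∀ r, 0 ≤ r → c r = F r) →
      IntervalIntegrable F volume 0 h := fun {c F} hc hF => by
    refine (hc.intervalIntegrable 0 h).congr fun r hr => ?_
    rw [uIoc_of_le h0] at hr
    exact hF r hr.1.le
  rw [intervalIntegral.integral_add (hii hc1 hc1') (hii hc2 hc2'), ← e1, ← e2,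
    ← integral_add i1 i2]
  have hsq := fun T => integrable_norm_sq_of_memLp (H.memLp_sol T)
  have hsq' : IntegrableOn (fun t => ‖θ (t - h)‖ ^ 2) (Iio T) := by
    have := (measurePreserving_sub_right volume h).integrableOn_comp_preimage
      (measurableEmbedding_subRight h) (f := fun t => ‖θ t‖ ^ 2) (s := Iio (T - h))
    have hs : (fun t => t - h) ⁻¹' Iio (T - h) = Iio T := by ext t; simp
    rw [hs] at this
    exact this.2 (hsq (T - h))
  have hshift : ∫ t in Iio T, ‖θ (t - h)‖ ^ 2 = ∫ t in Iio (T - h), ‖θ t‖ ^ 2 := by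
    have := (measurePreserving_sub_right volume h).setIntegral_preimage_emb
      (measurableEmbedding_subRight h) (fun t => ‖θ t‖ ^ 2) (Iio (T - h))
    have hs : (fun t => t - h) ⁻¹' Iio (T - h) = Iio T := by ext t; simp
    rwa [hs] at this
  -- The integral up to `T` of the shifted square is the integral up to `T - h` of the square, so
  -- only the last window survives.
  have hsplit : ∫ t in (T - h)..T, ‖θ t‖ ^ 2
      = ∫ t in Iio T, (‖θ t‖ ^ 2 - ‖θ (t - h)‖ ^ 2) := by
    rw [integral_sub (hsq T) hsq', hshift, intervalIntegral.integral_of_le (by linarith),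
      integral_Ioc_eq_integral_Ioo, ← integral_Ico_eq_integral_Ioo, eq_sub_iff_add_eq, add_comm,
      ← setIntegral_union _ measurableSet_Ico (hsq _)]
    · rw [Iio_union_Ico_eq_Iio (by linarith)]
    · exact (hsq T).mono_measure (Measure.restrict_mono Ico_subset_Iio_self le_rfl)
    · exact Set.disjoint_left.2 fun x hx hx' => absurd hx'.1 (not_le.2 hx)
  rw [hsplit]
  have hre : (∫ t in Iio T, (inner ℂ (θ t) (∫ s in (t - h)..t, a s)
      + inner ℂ (dθ t) (∫ s in (t - h)..t, b s))).re
      = ∫ t in Iio T, (inner ℂ (θ t) (∫ s in (t - h)..t, a s)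
      + inner ℂ (dθ t) (∫ s in (t - h)..t, b s)).re :=
    (integral_re (𝕜 := ℂ) (i1.add i2)).symm
  rw [hre, ← integral_const_mul]
  refine integral_mono_ae ((hsq T).sub hsq') ((i1.add i2).re.const_mul 2) ?_
  filter_upwards [ae_restrict_of_ae (H.ae_increment h), ae_restrict_of_ae H.mem] with t h1 h2
  have := h1 _ h2
  simp only at this
  simp only [← this]
  have h3 := norm_sub_sq (𝕜 := ℂ) (θ t) (θ t - θ (t - h))
  rw [sub_sub_cancel] at h3
  simp only [RCLike.re_to_complex] at h3
  nlinarith [sq_nonneg ‖θ t - θ (t - h)‖]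

/-- Both sides of `window_energy_le` vanish at `h = 0`, so their right slopes there compare. The
right side is differentiable by continuity of the correlations; the left has slope `‖θ T‖²` for
almost every `T`, by Lebesgue differentiation, and is nonnegative for all `T`. -/
theorem IsWeakEvolution.energy_le {V : Submodule ℂ (E × E)} {θ dθ a b : ℝ → E}
    (H : IsWeakEvolution V θ dθ a b) :
    (∀ T, 0 ≤ ∫ t in Iio T, (inner ℂ (θ t) (a t) + inner ℂ (dθ t) (b t)).re) ∧
    ∀ᵐ T : ℝ, ‖θ T‖ ^ 2
      ≤ 2 * ∫ t in Iio T, (inner ℂ (θ t) (a t) + inner ℂ (dθ t) (b t)).re := by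
  have hsq := fun T => integrable_norm_sq_of_memLp (H.memLp_sol T)
  have main : ∀ T, ∃ D : ℝ → ℝ, HasDerivAt D
      (2 * ∫ t in Iio T, (inner ℂ (θ t) (a t) + inner ℂ (dθ t) (b t)).re) 0 ∧ D 0 = 0 ∧
      ∀ h, 0 ≤ h → ∫ t in (T - h)..T, ‖θ t‖ ^ 2 ≤ D h := by
    intro T
    obtain ⟨c1, hc1, hc1'⟩ :=
      exists_continuous_setIntegral_inner_translate H.memLp_sol H.memLp_left T
    obtain ⟨c2, hc2, hc2'⟩ :=
      exists_continuous_setIntegral_inner_translate H.memLp_deriv H.memLp_right T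
    refine ⟨fun h => 2 * ∫ r in (0 : ℝ)..h, (c1 r + c2 r).re, ?_, by simp, fun h h0 => ?_⟩
    · have hcc : Continuous fun r => (c1 r + c2 r).re := Complex.continuous_re.comp (hc1.add hc2)
      have := (hcc.integral_hasStrictDerivAt 0 0).hasDerivAt.const_mul 2
      convert! this using 2
      simp only [hc1' 0 le_rfl, hc2' 0 le_rfl, sub_zero]
      have i1 : Integrable (fun t => inner ℂ (θ t) (a t)) (volume.restrict (Iio T)) :=
        integrable_inner_of_memLp (H.memLp_sol T) (H.memLp_left T)
      have i2 : Integrable (fun t => inner ℂ (dθ t) (b t)) (volume.restrict (Iio T)) :=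
        integrable_inner_of_memLp (H.memLp_deriv T) (H.memLp_right T)
      rw [← integral_add i1 i2]
      exact (integral_re (𝕜 := ℂ) (i1.add i2))
    · refine (H.window_energy_le T h0).trans_eq ?_
      have hic : IntervalIntegrable (fun r => c1 r + c2 r) volume 0 h :=
        (hc1.add hc2).intervalIntegrable 0 h
      have : ∫ r in (0 : ℝ)..h, ((∫ t in Iio T, inner ℂ (θ t) (a (t - r)))
          + ∫ t in Iio T, inner ℂ (dθ t) (b (t - r))) = ∫ r in (0 : ℝ)..h, (c1 r + c2 r) := by
        refine intervalIntegral.integral_congr fun r hr => ?_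
        rw [uIcc_of_le h0] at hr
        simp only [hc1' r hr.1, hc2' r hr.1]
      rw [this]
      congr 1
      exact (Complex.reCLM.intervalIntegral_comp_comm hic).symm
  have slope_le : ∀ {F D : ℝ → ℝ} {F' D' : ℝ}, HasDerivAt F F' 0 → HasDerivAt D D' 0 →
      F 0 = 0 → D 0 = 0 → (∀ h, 0 ≤ h → F h ≤ D h) → F' ≤ D' := by
    intro F D F' D' hF hD hF0 hD0 hle
    have t1 := hF.hasDerivWithinAt (s := Ioi 0)
    have t2 := hD.hasDerivWithinAt (s := Ioi 0)
    rw [hasDerivWithinAt_iff_tendsto_slope' (by simp)] at t1 t2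
    refine le_of_tendsto_of_tendsto t1 t2 ?_
    filter_upwards [self_mem_nhdsWithin] with h hh
    have hh : 0 < h := hh
    simp only [slope, hF0, hD0, sub_zero, vsub_eq_sub, smul_eq_mul]
    exact mul_le_mul_of_nonneg_left (hle h hh.le) (by positivity)
  constructor
  · intro T
    obtain ⟨D, hD, hD0, hle⟩ := main T
    have := slope_le (hasDerivAt_const 0 (0 : ℝ)) hD rfl hD0 fun h h0 =>
      (intervalIntegral.integral_nonneg (by linarith) fun t _ => by positivity).trans (hle h h0)
    linarith
  · have hloc : LocallyIntegrable (fun t => ‖θ t‖ ^ 2) volume := by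
      intro x
      exact ⟨Iio (x + 1), Iio_mem_nhds (by linarith), hsq (x + 1)⟩
    filter_upwards [LocallyIntegrable.ae_hasDerivAt_integral hloc] with T hT
    obtain ⟨D, hD, hD0, hle⟩ := main T
    have hT' := hT T
    have hder : HasDerivAt (fun h => ∫ t in (T - h)..T, ‖θ t‖ ^ 2) (‖θ T‖ ^ 2) 0 := by
      have h1 : HasDerivAt (fun h : ℝ => T - h) (-1) 0 := by
        simpa using (hasDerivAt_id (0 : ℝ)).const_sub T
      have h2 := (HasDerivAt.comp (h := fun h : ℝ => T - h)
        (h₂ := fun x => ∫ t in T..x, ‖θ t‖ ^ 2) (h₂' := ‖θ T‖ ^ 2) 0 (by simpa using hT') h1).neg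
      convert! h2 using 1
      · funext h
        simp [intervalIntegral.integral_symm T (T - h)]
      · ring
    exact slope_le hder hD (by simp) hD0 hle

end Energy

/-! ### Testing with transported vectors: the oscillation estimate. -/

section Modulated

open Filter Topology

variable {E : Type*} [NormedAddCommGroup E] [InnerProductSpace ℂ E] [CompleteSpace E]
  [SecondCountableTopology E]

omit [SecondCountableTopology E] in
theorem intervalIntegral_inner_primitive {f g : ℝ → E} {a b : ℝ} (hab : a ≤ b)
    (hf : IntervalIntegrable f volume a b) (hg : IntervalIntegrable g volume a b) :
    ∫ s in a..b, (inner ℂ (f s) (∫ r in a..s, g r) + inner ℂ (∫ r in a..s, f r) (g s))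
      = inner ℂ (∫ s in a..b, f s) (∫ s in a..b, g s) :=
  intervalIntegral_bilin_primitive
    (isBoundedBilinearMap_inner (𝕜 := ℂ) (E := E)).toContinuousLinearMap hab hf hg

/-- Weak formulation with a time-dependent test vector. -/
theorem IsWeakEvolution.ae_increment_curve {V : Submodule ℂ (E × E)} {θ dθ a b : ℝ → E}
    (H : IsWeakEvolution V θ dθ a b) {h : ℝ} (h0 : 0 ≤ h) :
    ∀ᵐ t : ℝ, ∀ φ φ' : ℝ → E × E, Continuous φ' → (∀ s, HasDerivAt φ (φ' s) s) →
      (∀ s, φ s ∈ V) → (∀ s, φ' s ∈ V) →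
      inner ℂ (φ t).1 (θ t) - inner ℂ (φ (t - h)).1 (θ (t - h))
        = ∫ s in (t - h)..t, (inner ℂ (φ s).1 (a s) + inner ℂ (φ s).2 (b s)
            + inner ℂ (φ' s).1 (θ s)) := by
  have ia := intervalIntegrable_of_memLp_Iio H.memLp_left
  have ib := intervalIntegrable_of_memLp_Iio H.memLp_right
  have iθ := intervalIntegrable_of_memLp_Iio H.memLp_sol
  filter_upwards [H.ae_forall, ae_translate H.ae_forall h] with t h1 h2 φ φ' hc hd hV hV'
  have hle : t - h ≤ t := by linarith
  have hφc : Continuous φ := continuous_iff_continuousAt.2 fun s => (hd s).continuousAt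
  have inc : ∀ {t' : ℝ}, (∀ p ∈ V, inner ℂ p.1 (θ t')
      = inner ℂ p.1 (∫ s in (0 : ℝ)..t', a s) + inner ℂ p.2 (∫ s in (0 : ℝ)..t', b s)) →
      ∀ p ∈ V, inner ℂ p.1 (∫ s in (t - h)..t', a s) + inner ℂ p.2 (∫ s in (t - h)..t', b s)
        = inner ℂ p.1 (θ t') - inner ℂ p.1 (θ (t - h)) := by
    intro t' h3 p hp
    rw [h3 p hp, h2 p hp, ← intervalIntegral.integral_interval_sub_left (ia 0 t') (ia 0 (t - h)),
      ← intervalIntegral.integral_interval_sub_left (ib 0 t') (ib 0 (t - h)),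
      inner_sub_right, inner_sub_right]
    ring
  have hd1 : ∀ s, HasDerivAt (fun s => (φ s).1) (φ' s).1 s := fun s =>
    (ContinuousLinearMap.fst ℝ E E).hasFDerivAt.comp_hasDerivAt s (hd s)
  have hd2 : ∀ s, HasDerivAt (fun s => (φ s).2) (φ' s).2 s := fun s =>
    (ContinuousLinearMap.snd ℝ E E).hasFDerivAt.comp_hasDerivAt s (hd s)
  have c1 : Continuous fun s => (φ' s).1 := continuous_fst.comp hc
  have c2 : Continuous fun s => (φ' s).2 := continuous_snd.comp hc
  have f1 : ∀ s, ∫ r in (t - h)..s, (φ' r).1 = (φ s).1 - (φ (t - h)).1 := fun s =>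
    intervalIntegral.integral_eq_sub_of_hasDerivAt (fun r _ => hd1 r) (c1.intervalIntegrable _ _)
  have f2 : ∀ s, ∫ r in (t - h)..s, (φ' r).2 = (φ s).2 - (φ (t - h)).2 := fun s =>
    intervalIntegral.integral_eq_sub_of_hasDerivAt (fun r _ => hd2 r) (c2.intervalIntegrable _ _)
  have e1 := intervalIntegral_inner_primitive hle (c1.intervalIntegrable _ _) (ia (t - h) t)
  have e2 := intervalIntegral_inner_primitive hle (c2.intervalIntegrable _ _) (ib (t - h) t)
  simp only [f1] at e1
  simp only [f2] at e2
  have iin : ∀ {f g : ℝ → E}, Continuous f → IntervalIntegrable g volume (t - h) t →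
      IntervalIntegrable (fun s => inner ℂ (f s) (g s)) volume (t - h) t := by
    intro f g hf hg
    rw [intervalIntegrable_iff] at hg ⊢
    obtain ⟨C, hC⟩ := (isCompact_uIcc (a := t - h) (b := t)).exists_bound_of_continuousOn
      hf.continuousOn
    refine (isBoundedBilinearMap_inner (𝕜 := ℂ) (E := E)).toContinuousLinearMap
      |>.integrable_of_bilin_of_bdd_left C hf.aestronglyMeasurable ?_ hg
    filter_upwards [ae_restrict_mem measurableSet_uIoc] with s hs
    exact hC s (uIoc_subset_uIcc hs)
  have cprim : ∀ {g : ℝ → E}, (∀ x y, IntervalIntegrable g volume x y) →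
      Continuous fun s => ∫ r in (t - h)..s, g r := fun hg =>
    intervalIntegral.continuous_primitive hg _
  have j1 : IntervalIntegrable (fun s => inner ℂ (φ' s).1 (∫ r in (t - h)..s, a r)
      + inner ℂ ((φ s).1 - (φ (t - h)).1) (a s)) volume (t - h) t :=
    (iin c1 ((cprim ia).intervalIntegrable _ _)).add (iin (by fun_prop) (ia _ _))
  have j2 : IntervalIntegrable (fun s => inner ℂ (φ' s).2 (∫ r in (t - h)..s, b r)
      + inner ℂ ((φ s).2 - (φ (t - h)).2) (b s)) volume (t - h) t :=
    (iin c2 ((cprim ib).intervalIntegrable _ _)).add (iin (by fun_prop) (ib _ _))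
  have e3 := congrArg₂ (· + ·) e1 e2
  beta_reduce at e3
  rw [← intervalIntegral.integral_add j1 j2] at e3
  have e4 : ∫ s in (t - h)..t, (inner ℂ (φ' s).1 (∫ r in (t - h)..s, a r)
      + inner ℂ ((φ s).1 - (φ (t - h)).1) (a s) + (inner ℂ (φ' s).2 (∫ r in (t - h)..s, b r)
      + inner ℂ ((φ s).2 - (φ (t - h)).2) (b s)))
      = ∫ s in (t - h)..t, ((inner ℂ (φ s).1 (a s) + inner ℂ (φ s).2 (b s)
            + inner ℂ (φ' s).1 (θ s)) - (inner ℂ (φ' s).1 (θ (t - h))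
            + (inner ℂ (φ (t - h)).1 (a s) + inner ℂ (φ (t - h)).2 (b s)))) := by
    -- The weak form at time `s`, tested with `φ' s`, trades the primitives of `a` and `b` for `θ s
    -- - θ (t - h)`.
    refine intervalIntegral.integral_congr_ae ?_
    filter_upwards [H.ae_forall] with s hs _
    have := inc hs _ (hV' s)
    simp only [inner_sub_left]
    linear_combination this
  have k1 : ∫ s in (t - h)..t, inner ℂ (φ' s).1 (θ (t - h))
      = inner ℂ ((φ t).1 - (φ (t - h)).1) (θ (t - h)) := by
    rw [← f1 t]
    have := intervalIntegral.integral_eq_sub_of_hasDerivAt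
      (f := fun s => inner ℂ (φ s).1 (θ (t - h))) (a := t - h) (b := t)
      (f' := fun s => inner ℂ (φ' s).1 (θ (t - h)))
      (fun r _ => by simpa using (hd1 r).inner ℂ (hasDerivAt_const r (θ (t - h))))
      ((by fun_prop : Continuous _).intervalIntegrable _ _)
    rw [this, f1, inner_sub_left]
  have k2 : ∫ s in (t - h)..t, inner ℂ (φ (t - h)).1 (a s)
      = inner ℂ (φ (t - h)).1 (∫ s in (t - h)..t, a s) :=
    (innerSL ℂ (φ (t - h)).1).intervalIntegral_comp_comm (ia _ _)
  have k3 : ∫ s in (t - h)..t, inner ℂ (φ (t - h)).2 (b s)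
      = inner ℂ (φ (t - h)).2 (∫ s in (t - h)..t, b s) :=
    (innerSL ℂ (φ (t - h)).2).intervalIntegral_comp_comm (ib _ _)
  have m1 : IntervalIntegrable (fun s => inner ℂ (φ s).1 (a s)) volume (t - h) t :=
    iin (continuous_fst.comp hφc) (ia (t - h) t)
  have m2 : IntervalIntegrable (fun s => inner ℂ (φ s).2 (b s)) volume (t - h) t :=
    iin (continuous_snd.comp hφc) (ib (t - h) t)
  have m3 := iin c1 (iθ (t - h) t)
  have m4 : IntervalIntegrable (fun s => inner ℂ (φ' s).1 (θ (t - h))) volume (t - h) t :=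
    iin c1 intervalIntegrable_const
  have m5 : IntervalIntegrable (fun s => inner ℂ (φ (t - h)).1 (a s)) volume (t - h) t :=
    iin continuous_const (ia _ _)
  have m6 : IntervalIntegrable (fun s => inner ℂ (φ (t - h)).2 (b s)) volume (t - h) t :=
    iin continuous_const (ib _ _)
  rw [e4, intervalIntegral.integral_sub ((m1.add m2).add m3) (m4.add (m5.add m6)),
    intervalIntegral.integral_add m4 (m5.add m6), intervalIntegral.integral_add m5 m6,
    k1, k2, k3, inner_sub_left, inner_sub_left, inner_sub_left] at e3
  linear_combination -(inc h1 _ (hV t)) - e3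

/-- The test curve `s ↦ exp(-iκ(s - t)Y) θ t` equals `θ t` at `s = t`, and at `s = t - h` its
pairing with `θ (t - h)` is small by oscillation. The combination `a + iκYθ` is what remains of `a`
once the transport term is removed. -/
theorem IsWeakEvolution.ae_norm_sq_le {V : Submodule ℂ (E × E)} (hV : IsClosed (V : Set (E × E)))
    {Y : E →L[ℂ] E} (hY : IsSelfAdjoint Y) (hYV : ∀ p ∈ V, (Y p.1, p.1 + Y p.2) ∈ V)
    (hparts : ∀ p ∈ V, ∀ q ∈ V, inner ℂ p.2 q.1 + inner ℂ p.1 q.2 = 0)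
    {θ dθ a b : ℝ → E} (H : IsWeakEvolution V θ dθ a b) (κ : ℝ) {h : ℝ} (h0 : 0 < h) :
    ∀ᵐ t : ℝ, |κ| * h * ‖θ t‖ ^ 2 ≤ ‖dθ t‖ * ‖θ (t - h)‖ + ‖θ t‖ * ‖dθ (t - h)‖
      + |κ| * h * ∫ s in (t - h)..t, (‖θ t‖ * ‖a s + (Complex.I * κ) • Y (θ s)‖
          + (‖dθ t‖ + |κ| * h * ‖θ t‖) * ‖b s‖) := by
  have ia := intervalIntegrable_of_memLp_Iio H.memLp_left
  have ib := intervalIntegrable_of_memLp_Iio H.memLp_right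
  have iθ := intervalIntegrable_of_memLp_Iio H.memLp_sol
  filter_upwards [H.ae_increment_curve h0.le, H.mem, ae_translate H.mem h] with t h1 h2 h3
  set w : E × E := (θ t, dθ t) with hw
  have hmem : ∀ s, modulationPair Y κ s w ∈ V := fun s => modulationPair_mem hV hYV κ s h2
  have hder : ∀ s, HasDerivAt (fun s => modulationPair Y κ (s - t) w)
      (modulationGenerator Y κ (modulationPair Y κ (s - t) w)) s := fun s => by
    simpa using (hasDerivAt_modulationPair Y κ (s - t) w).comp_sub_const s t
  have hcont : Continuous fun s => modulationPair Y κ (s - t) w :=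
    continuous_iff_continuousAt.2 fun s => (hder s).continuousAt
  have e := h1 (fun s => modulationPair Y κ (s - t) w)
    (fun s => modulationGenerator Y κ (modulationPair Y κ (s - t) w))
    ((modulationGenerator Y κ).continuous.comp hcont) hder (fun s => hmem _)
    (fun s => V.smul_mem _ (hYV _ (hmem _)))
  have hzero : modulationPair Y κ (t - t) w = w := by
    simp [modulationPair, modulation_zero, hw]
  have hneg : t - h - t = -h := by ring
  simp only [hzero, hneg] at e
  set u := modulation Y κ (-h) (θ t) with hu
  -- Integration by parts between the modulated pair and `(θ (t - h), dθ (t - h))`: differentiating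
  -- the modulation produces the factor `iκh`, and unitarity removes the modulation from the norms.
  have hA : |κ| * h * ‖inner ℂ u (θ (t - h))‖ ≤ ‖dθ t‖ * ‖θ (t - h)‖ + ‖θ t‖ * ‖dθ (t - h)‖ := by
    have hp := hparts _ (hmem (-h)) _ h3
    simp only [modulationPair, hw, map_sub, map_smul, inner_sub_left, inner_smul_left] at hp
    have hp' : (Complex.I * κ * h) * inner ℂ u (θ (t - h))
        = inner ℂ (modulation Y κ (-h) (dθ t)) (θ (t - h)) + inner ℂ u (dθ (t - h)) := by
      simp only [map_mul, Complex.conj_I, Complex.conj_ofReal, Complex.ofReal_neg, map_neg] at hp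
      linear_combination -hp
    have hn : ‖(Complex.I * κ * h) * inner ℂ u (θ (t - h))‖
        = |κ| * h * ‖inner ℂ u (θ (t - h))‖ := by
      simp [abs_of_pos h0]
    rw [← hn, hp']
    refine (norm_add_le _ _).trans (add_le_add ?_ ?_)
    · refine (norm_inner_le_norm _ _).trans_eq ?_
      rw [norm_modulation hY]
    · refine (norm_inner_le_norm _ _).trans_eq ?_
      rw [norm_modulation hY]
  have hB : ‖∫ s in (t - h)..t, (inner ℂ (modulationPair Y κ (s - t) w).1 (a s)
      + inner ℂ (modulationPair Y κ (s - t) w).2 (b s)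
      + inner ℂ (modulationGenerator Y κ (modulationPair Y κ (s - t) w)).1 (θ s))‖
      ≤ ∫ s in (t - h)..t, (‖θ t‖ * ‖a s + (Complex.I * κ) • Y (θ s)‖
          + (‖dθ t‖ + |κ| * h * ‖θ t‖) * ‖b s‖) := by
    refine intervalIntegral.norm_integral_le_of_norm_le (by linarith) ?_ ?_
    · refine .of_forall fun s hs => ?_
      -- Self-adjointness of `Y` moves the time derivative of the test vector onto `θ s` as a
      -- transport term.
      have e1 : inner ℂ (modulationGenerator Y κ (modulationPair Y κ (s - t) w)).1 (θ s)
          = inner ℂ (modulationPair Y κ (s - t) w).1 ((Complex.I * κ) • Y (θ s)) := by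
        have : (modulationGenerator Y κ (modulationPair Y κ (s - t) w)).1
            = (-(Complex.I * κ)) • Y (modulationPair Y κ (s - t) w).1 := rfl
        rw [this, inner_smul_left, inner_smul_right,
          ← ContinuousLinearMap.adjoint_inner_right, hY.adjoint_eq]
        simp
      rw [e1, add_right_comm, ← inner_add_right]
      refine (norm_add_le _ _).trans (add_le_add ?_ ?_)
      · refine (norm_inner_le_norm _ _).trans_eq ?_
        simp only [modulationPair, norm_modulation hY, hw]
      · refine (norm_inner_le_norm _ _).trans ?_
        refine mul_le_mul_of_nonneg_right ?_ (norm_nonneg _)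
        simp only [modulationPair, norm_modulation hY, hw]
        refine (norm_sub_le _ _).trans (add_le_add le_rfl ?_)
        rw [norm_smul]
        refine mul_le_mul_of_nonneg_right ?_ (norm_nonneg _)
        rw [norm_mul, norm_mul, Complex.norm_real, Complex.norm_real,
          Complex.norm_I, one_mul, mul_comm]
        refine mul_le_mul_of_nonneg_left ?_ (abs_nonneg _)
        rw [Real.norm_eq_abs, abs_le]
        constructor <;> linarith [hs.1, hs.2]
    · have iY : IntervalIntegrable (fun s => Y (θ s)) volume (t - h) t :=
        ⟨Y.integrable_comp (iθ _ _).1, Y.integrable_comp (iθ _ _).2⟩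
      exact (((ia _ _).add (iY.smul _)).norm.const_mul _).add ((ib _ _).norm.const_mul _)
  rw [← e] at hB
  have hin : inner ℂ w.1 (θ t) = ((‖θ t‖ : ℂ)) ^ 2 := inner_self_eq_norm_sq_to_K (𝕜 := ℂ) (θ t)
  have hC : ‖θ t‖ ^ 2 ≤ ‖inner ℂ u (θ (t - h))‖ + ‖inner ℂ w.1 (θ t)
      - inner ℂ (modulationPair Y κ (-h) w).1 (θ (t - h))‖ := by
    have : ‖inner ℂ w.1 (θ t)‖ = ‖θ t‖ ^ 2 := by rw [hin]; simp
    rw [← this]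
    have h5 := norm_add_le (inner ℂ u (θ (t - h))) (inner ℂ w.1 (θ t)
      - inner ℂ (modulationPair Y κ (-h) w).1 (θ (t - h)))
    have h6 : (modulationPair Y κ (-h) w).1 = u := rfl
    rw [h6] at h5 ⊢
    simpa using h5
  have hkh : 0 ≤ |κ| * h := by positivity
  nlinarith [mul_le_mul_of_nonneg_left (hC.trans (add_le_add le_rfl hB)) hkh]

end Modulated

/-! ### A priori estimates for the abstract sheared heat equation. -/

section ShearEstimate

open Filter Topology

theorem setIntegral_shift_le {q : ℝ → ℝ} {T h : ℝ} (h0 : 0 ≤ h) (hq0 : ∀ t, 0 ≤ q t)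
    (hq : IntegrableOn q (Iio T)) :
    IntegrableOn (fun t => q (t - h)) (Iio T) ∧
      ∫ t in Iio T, q (t - h) ≤ ∫ t in Iio T, q t := by
  have hs : (fun t => t - h) ⁻¹' Iio (T - h) = Iio T := by ext t; simp
  have hsub : Iio (T - h) ⊆ Iio T := Iio_subset_Iio (by linarith)
  constructor
  · have := (measurePreserving_sub_right volume h).integrableOn_comp_preimage
      (measurableEmbedding_subRight h) (f := q) (s := Iio (T - h))
    rw [hs] at this
    exact this.2 (hq.mono_set hsub)
  · have := (measurePreserving_sub_right volume h).setIntegral_preimage_emb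
      (measurableEmbedding_subRight h) q (Iio (T - h))
    rw [hs] at this
    rw [this]
    exact setIntegral_mono_set hq (.of_forall hq0) hsub.eventuallyLE

theorem integral_linearCombination_four {α : Type*} {m : MeasurableSpace α} {ν : Measure α}
    {f₁ f₂ f₃ f₄ : α → ℝ} (h₁ : Integrable f₁ ν) (h₂ : Integrable f₂ ν) (h₃ : Integrable f₃ ν)
    (h₄ : Integrable f₄ ν) (c₁ c₂ c₃ c₄ : ℝ) :
    Integrable (fun t => c₁ * f₁ t + c₂ * f₂ t + c₃ * f₃ t + c₄ * f₄ t) ν ∧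
      ∫ t, (c₁ * f₁ t + c₂ * f₂ t + c₃ * f₃ t + c₄ * f₄ t) ∂ν
        = c₁ * ∫ t, f₁ t ∂ν + c₂ * ∫ t, f₂ t ∂ν + c₃ * ∫ t, f₃ t ∂ν + c₄ * ∫ t, f₄ t ∂ν := by
  have k₁ := h₁.const_mul c₁
  have k₂ := h₂.const_mul c₂
  have k₃ := h₃.const_mul c₃
  have k₄ := h₄.const_mul c₄
  have k₁₂ : Integrable (fun t => c₁ * f₁ t + c₂ * f₂ t) ν := k₁.add k₂
  have k₁₂₃ : Integrable (fun t => c₁ * f₁ t + c₂ * f₂ t + c₃ * f₃ t) ν := k₁₂.add k₃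
  refine ⟨k₁₂₃.add k₄, ?_⟩
  rw [integral_add k₁₂₃ k₄, integral_add k₁₂ k₃, integral_add k₁ k₂]
  simp only [integral_const_mul]

theorem mul_le_young {ε x y z : ℝ} (hε : 0 < ε) (hz : 1 ≤ 4 * ε * z) :
    x * y ≤ ε * x ^ 2 + z * y ^ 2 := by
  have h1 : 0 ≤ (2 * ε * x - y) ^ 2 := sq_nonneg _
  have h2 : 0 ≤ (4 * ε * z - 1) * y ^ 2 := mul_nonneg (by linarith) (sq_nonneg y)
  have h3 : 0 ≤ 4 * ε * (ε * x ^ 2 + z * y ^ 2 - x * y) := by nlinarith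
  have := nonneg_of_mul_nonneg_right h3 (by positivity)
  linarith

variable {E : Type*} [NormedAddCommGroup E] [InnerProductSpace ℂ E] [CompleteSpace E]
  [SecondCountableTopology E]

/-- The zeroth order part of the right-hand side of the sheared heat equation. -/
def shearLower (μ κ : ℝ) (Y : E →L[ℂ] E) (θ g : ℝ → E) (t : ℝ) : E :=
  -(((μ * κ ^ 2 : ℝ) : ℂ) • θ t + (Complex.I * κ) • Y (θ t) + (Complex.I * κ) • g t)

/-- The flux in the right-hand side of the sheared heat equation. -/
def shearFlux (μ : ℝ) (dθ g : ℝ → E) (t : ℝ) : E := g t - (μ : ℂ) • dθ t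

theorem norm_I_mul_ofReal (κ : ℝ) : ‖Complex.I * (κ : ℂ)‖ = |κ| := by simp

-- Since `Y` is self-adjoint, `iκ ⟪θ, Yθ⟫` is purely imaginary: the shear neither creates nor
-- destroys energy.
omit [SecondCountableTopology E] in
theorem re_inner_shear_le {Y : E →L[ℂ] E} (hY : IsSelfAdjoint Y) (μ κ : ℝ)
    (θ dθ g₁ g₂ : ℝ → E) (t : ℝ) :
    (inner ℂ (θ t) (shearLower μ κ Y θ g₁ t) + inner ℂ (dθ t) (shearFlux μ dθ g₂ t)).re
      ≤ -(μ * κ ^ 2 * ‖θ t‖ ^ 2) - μ * ‖dθ t‖ ^ 2 + |κ| * (‖g₁ t‖ * ‖θ t‖)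
        + ‖g₂ t‖ * ‖dθ t‖ := by
  have hYr : (inner ℂ (θ t) (Y (θ t))).im = 0 := by
    have h1 : inner ℂ (Y (θ t)) (θ t) = inner ℂ (θ t) (Y (θ t)) := by
      rw [← ContinuousLinearMap.adjoint_inner_right, hY.adjoint_eq]
    have h2 := inner_conj_symm (𝕜 := ℂ) (θ t) (Y (θ t))
    rw [h1] at h2
    exact Complex.conj_eq_iff_im.1 h2
  have hθ : (inner ℂ (θ t) (θ t) : ℂ) = ((‖θ t‖ ^ 2 : ℝ) : ℂ) := by
    rw [inner_self_eq_norm_sq_to_K]; push_cast; rfl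
  have hd : (inner ℂ (dθ t) (dθ t) : ℂ) = ((‖dθ t‖ ^ 2 : ℝ) : ℂ) := by
    rw [inner_self_eq_norm_sq_to_K]; push_cast; rfl
  have e1 : -((Complex.I * κ) * inner ℂ (θ t) (g₁ t)).re ≤ |κ| * (‖g₁ t‖ * ‖θ t‖) := by
    refine (neg_le_abs _).trans ((Complex.abs_re_le_norm _).trans ?_)
    rw [norm_mul, norm_I_mul_ofReal]
    refine mul_le_mul_of_nonneg_left ?_ (abs_nonneg _)
    rw [mul_comm]
    exact norm_inner_le_norm _ _
  have e2 : (inner ℂ (dθ t) (g₂ t)).re ≤ ‖g₂ t‖ * ‖dθ t‖ := by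
    refine (Complex.re_le_norm _).trans ?_
    rw [mul_comm]
    exact norm_inner_le_norm _ _
  have e3 : ((Complex.I * κ) * inner ℂ (θ t) (Y (θ t))).re = 0 := by
    simp [hYr]
  simp only [shearLower, shearFlux, inner_neg_right, inner_add_right, inner_smul_right,
    inner_sub_right, hθ, hd, Complex.add_re, Complex.sub_re, Complex.neg_re, e3,
    ← Complex.ofReal_mul, Complex.ofReal_re]
  linarith

/-- A weak solution of the abstract sheared heat equation
`∂ₜ θ = μ (∂² - κ²) θ - i κ Y θ - i κ g₁ - ∂ g₂` with square-integrable data. -/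
structure IsShearEvolution (V : Submodule ℂ (E × E)) (Y : E →L[ℂ] E) (μ κ : ℝ)
    (θ dθ g₁ g₂ : ℝ → E) : Prop where
  isWeakEvolution : IsWeakEvolution V θ dθ (shearLower μ κ Y θ g₁) (shearFlux μ dθ g₂)
  memLp_g₁ : ∀ T, MemLp g₁ 2 (volume.restrict (Iio T))
  memLp_g₂ : ∀ T, MemLp g₂ 2 (volume.restrict (Iio T))

variable {V : Submodule ℂ (E × E)} {Y : E →L[ℂ] E} {μ κ : ℝ} {θ dθ g₁ g₂ : ℝ → E}

omit [SecondCountableTopology E] in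
theorem IsShearEvolution.integral_re_le (H : IsShearEvolution V Y μ κ θ dθ g₁ g₂)
    (hY : IsSelfAdjoint Y) {c₁ c₂ c₃ c₄ : ℝ}
    (h : ∀ t, -(μ * κ ^ 2 * ‖θ t‖ ^ 2) - μ * ‖dθ t‖ ^ 2 + |κ| * (‖g₁ t‖ * ‖θ t‖)
        + ‖g₂ t‖ * ‖dθ t‖ ≤ c₁ * ‖θ t‖ ^ 2 + c₂ * ‖dθ t‖ ^ 2 + c₃ * ‖g₁ t‖ ^ 2 + c₄ * ‖g₂ t‖ ^ 2)
    (T : ℝ) :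
    ∫ t in Iio T, (inner ℂ (θ t) (shearLower μ κ Y θ g₁ t)
        + inner ℂ (dθ t) (shearFlux μ dθ g₂ t)).re
      ≤ c₁ * (∫ t in Iio T, ‖θ t‖ ^ 2) + c₂ * (∫ t in Iio T, ‖dθ t‖ ^ 2)
        + c₃ * (∫ t in Iio T, ‖g₁ t‖ ^ 2) + c₄ * ∫ t in Iio T, ‖g₂ t‖ ^ 2 := by
  have i1 := integrable_norm_sq_of_memLp (H.isWeakEvolution.memLp_sol T)
  have i2 := integrable_norm_sq_of_memLp (H.isWeakEvolution.memLp_deriv T)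
  have i3 := integrable_norm_sq_of_memLp (H.memLp_g₁ T)
  have i4 := integrable_norm_sq_of_memLp (H.memLp_g₂ T)
  obtain ⟨i5, e5⟩ := integral_linearCombination_four i1 i2 i3 i4 c₁ c₂ c₃ c₄
  rw [← e5]
  refine integral_mono ?_ i5
    fun t => (re_inner_shear_le hY μ κ θ dθ g₁ g₂ t).trans (h t)
  exact ((integrable_inner_of_memLp (H.isWeakEvolution.memLp_sol T)
    (H.isWeakEvolution.memLp_left T)).add (integrable_inner_of_memLp
    (H.isWeakEvolution.memLp_deriv T) (H.isWeakEvolution.memLp_right T))).re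

/-- The oscillation estimate with window `h = τ`, divided by `|κ| τ` and integrated in time. Five
applications of Young's inequality each cost `1/16` of `∫ ‖θ‖²`, which leaves the factor `11/16`. -/
theorem IsShearEvolution.integral_norm_sq_le (hV : IsClosed (V : Set (E × E)))
    (hY : IsSelfAdjoint Y) (hYV : ∀ p ∈ V, (Y p.1, p.1 + Y p.2) ∈ V)
    (hparts : ∀ p ∈ V, ∀ q ∈ V, inner ℂ p.2 q.1 + inner ℂ p.1 q.2 = 0)
    (H : IsShearEvolution V Y μ κ θ dθ g₁ g₂) (hμ : 0 < μ) (hκ : κ ≠ 0) {τ : ℝ} (hτ : 0 < τ)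
    (hscale : μ * κ ^ 2 * τ ^ 3 = 1) (T : ℝ) :
    11 / 16 * (∫ t in Iio T, ‖θ t‖ ^ 2) ≤ τ * (27 / 2 * μ * (∫ t in Iio T, ‖dθ t‖ ^ 2)
      + μ * κ ^ 2 * (∫ t in Iio T, ‖θ t‖ ^ 2) + 4 * τ * κ ^ 2 * (∫ t in Iio T, ‖g₁ t‖ ^ 2)
      + 9 / 2 * μ⁻¹ * ∫ t in Iio T, ‖g₂ t‖ ^ 2) := by
  have W := H.isWeakEvolution
  have i1 := integrable_norm_sq_of_memLp (W.memLp_sol T)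
  have i2 := integrable_norm_sq_of_memLp (W.memLp_deriv T)
  have i3 := integrable_norm_sq_of_memLp (H.memLp_g₁ T)
  have i4 := integrable_norm_sq_of_memLp (H.memLp_g₂ T)
  -- `q` collects the Young terms at the running time `s`; `P` below collects those at the fixed
  -- time `t`.
  set q : ℝ → ℝ := fun s => μ * κ ^ 2 / 2 * ‖θ s‖ ^ 2 + 9 / 2 * μ * ‖dθ s‖ ^ 2
    + 4 * τ * κ ^ 2 * ‖g₁ s‖ ^ 2 + 9 / 2 * μ⁻¹ * ‖g₂ s‖ ^ 2 with hq
  have hq0 : ∀ t, 0 ≤ q t := fun t => by positivity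
  have hqi : IntegrableOn q (Iio T) :=
    (((i1.const_mul _).add (i2.const_mul _)).add (i3.const_mul _)).add (i4.const_mul _)
  obtain ⟨w1, w2⟩ := setIntegral_translate_le hτ.le hq0 hqi
  obtain ⟨s1, s2⟩ := setIntegral_shift_le hτ.le (fun t => by positivity) i1
  obtain ⟨s3, s4⟩ := setIntegral_shift_le hτ.le (fun t => by positivity) i2
  have hμτ : μ * τ * (|κ| * τ) ^ 2 = 1 := by
    rw [mul_pow, sq_abs]; linarith
  have hκ' : 0 < |κ| := abs_pos.2 hκ
  have hx : 0 < |κ| * τ := by positivity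
  have point : ∀ᵐ t ∂(volume.restrict (Iio T)), ‖θ t‖ ^ 2 ≤
      (1 / 16 + τ * (μ * κ ^ 2 / 2) + 3 / 16) * ‖θ t‖ ^ 2 + (4 * μ * τ + τ * μ) * ‖dθ t‖ ^ 2
      + 1 / 16 * ‖θ (t - τ)‖ ^ 2 + 4 * μ * τ * ‖dθ (t - τ)‖ ^ 2 + ∫ s in (t - τ)..t, q s := by
    filter_upwards [ae_restrict_of_ae (W.ae_norm_sq_le hV hY hYV hparts κ hτ),
      ae_restrict_mem measurableSet_Iio] with t ht htT
    have iiq : IntervalIntegrable q volume (t - τ) t := by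
      rw [intervalIntegrable_iff_integrableOn_Ioc_of_le (by linarith)]
      exact hqi.mono_set fun s hs => lt_of_le_of_lt hs.2 htT
    have iia := intervalIntegrable_of_memLp_Iio W.memLp_left (t - τ) t
    have iib := intervalIntegrable_of_memLp_Iio W.memLp_right (t - τ) t
    have iiθ := intervalIntegrable_of_memLp_Iio W.memLp_sol (t - τ) t
    have iiY : IntervalIntegrable (fun s => Y (θ s)) volume (t - τ) t :=
      ⟨Y.integrable_comp iiθ.1, Y.integrable_comp iiθ.2⟩
    set P : ℝ := (μ * κ ^ 2 / 2 + 3 / 16 * τ⁻¹) * ‖θ t‖ ^ 2 + μ * ‖dθ t‖ ^ 2 with hP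
    have hF : ∫ s in (t - τ)..t, (‖θ t‖ * ‖shearLower μ κ Y θ g₁ s + (Complex.I * κ) • Y (θ s)‖
          + (‖dθ t‖ + |κ| * τ * ‖θ t‖) * ‖shearFlux μ dθ g₂ s‖)
        ≤ ∫ s in (t - τ)..t, (P + q s) := by
      refine intervalIntegral.integral_mono_on (by linarith)
        (((iia.add (iiY.smul _)).norm.const_mul _).add (iib.norm.const_mul _))
        (intervalIntegrable_const.add iiq) fun s _ => ?_
      have b1 : ‖shearLower μ κ Y θ g₁ s + (Complex.I * κ) • Y (θ s)‖
          ≤ μ * κ ^ 2 * ‖θ s‖ + |κ| * ‖g₁ s‖ := by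
        have : shearLower μ κ Y θ g₁ s + (Complex.I * κ) • Y (θ s)
            = -(((μ * κ ^ 2 : ℝ) : ℂ) • θ s + (Complex.I * κ) • g₁ s) := by
          simp only [shearLower]; abel
        rw [this, norm_neg]
        refine (norm_add_le _ _).trans_eq ?_
        rw [norm_smul, norm_smul, norm_I_mul_ofReal, Complex.norm_real, Real.norm_of_nonneg]
        positivity
      have b2 : ‖shearFlux μ dθ g₂ s‖ ≤ ‖g₂ s‖ + μ * ‖dθ s‖ := by
        refine (norm_sub_le _ _).trans_eq ?_
        rw [norm_smul, Complex.norm_real, Real.norm_of_nonneg hμ.le]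
      have c1 : ‖θ t‖ * ‖θ s‖ ≤ 1 / 2 * ‖θ t‖ ^ 2 + 1 / 2 * ‖θ s‖ ^ 2 :=
        mul_le_young (by norm_num) (by norm_num)
      have c2 : ‖θ t‖ * (|κ| * ‖g₁ s‖) ≤ 1 / 16 * τ⁻¹ * ‖θ t‖ ^ 2
          + 4 * τ * (|κ| * ‖g₁ s‖) ^ 2 :=
        mul_le_young (by positivity) (by field_simp; norm_num)
      have c3 : ‖dθ t‖ * ‖dθ s‖ ≤ 1 / 2 * ‖dθ t‖ ^ 2 + 1 / 2 * ‖dθ s‖ ^ 2 :=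
        mul_le_young (by norm_num) (by norm_num)
      have c4 : ‖dθ t‖ * ‖g₂ s‖ ≤ 1 / 2 * μ * ‖dθ t‖ ^ 2 + 1 / 2 * μ⁻¹ * ‖g₂ s‖ ^ 2 :=
        mul_le_young (by positivity) (by field_simp; norm_num)
      -- This is where the choice of `τ` enters: a modulation factor `|κ| τ` costs the same as a
      -- derivative at the diffusive length `(μ τ)^(1/2)`.
      have hx2 : (|κ| * τ) ^ 2 = (μ * τ)⁻¹ := by
        field_simp; linarith
      have c5 : (|κ| * τ * ‖θ t‖) * ‖dθ s‖ ≤ 1 / 16 * μ⁻¹ * τ⁻¹ * (((|κ| * τ) * ‖θ t‖) ^ 2 * (μ * τ))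
          + 4 * ‖dθ s‖ ^ 2 := by
        have := mul_le_young (ε := 1 / 16) (z := 4) (x := (|κ| * τ) * ‖θ t‖) (y := ‖dθ s‖)
          (by norm_num) (by norm_num)
        refine this.trans_eq ?_
        field_simp
      have c6 : (|κ| * τ * ‖θ t‖) * ‖g₂ s‖ ≤ 1 / 16 * μ * (|κ| * τ * ‖θ t‖) ^ 2
          + 4 * μ⁻¹ * ‖g₂ s‖ ^ 2 :=
        mul_le_young (by positivity) (by field_simp; norm_num)
      have hxn : (|κ| * τ * ‖θ t‖) ^ 2 = μ⁻¹ * τ⁻¹ * ‖θ t‖ ^ 2 := by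
        rw [mul_pow, hx2, mul_inv]
      have c5' : μ * ((|κ| * τ * ‖θ t‖) * ‖dθ s‖) ≤ 1 / 16 * τ⁻¹ * ‖θ t‖ ^ 2
          + 4 * μ * ‖dθ s‖ ^ 2 := by
        refine (mul_le_mul_of_nonneg_left c5 hμ.le).trans_eq ?_
        rw [hxn]; field_simp
      have c6' : (|κ| * τ * ‖θ t‖) * ‖g₂ s‖ ≤ 1 / 16 * τ⁻¹ * ‖θ t‖ ^ 2
          + 4 * μ⁻¹ * ‖g₂ s‖ ^ 2 := by
        refine c6.trans_eq ?_
        rw [hxn]; field_simp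
      have c1' := mul_le_mul_of_nonneg_left c1 (show 0 ≤ μ * κ ^ 2 by positivity)
      have c3' := mul_le_mul_of_nonneg_left c3 hμ.le
      rw [mul_pow, sq_abs] at c2
      calc _ ≤ ‖θ t‖ * (μ * κ ^ 2 * ‖θ s‖ + |κ| * ‖g₁ s‖)
            + (‖dθ t‖ + |κ| * τ * ‖θ t‖) * (‖g₂ s‖ + μ * ‖dθ s‖) := by gcongr
        _ = μ * κ ^ 2 * (‖θ t‖ * ‖θ s‖) + ‖θ t‖ * (|κ| * ‖g₁ s‖) + μ * (‖dθ t‖ * ‖dθ s‖)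
            + ‖dθ t‖ * ‖g₂ s‖ + μ * ((|κ| * τ * ‖θ t‖) * ‖dθ s‖)
            + (|κ| * τ * ‖θ t‖) * ‖g₂ s‖ := by ring
        _ ≤ P + q s := by
          simp only [hP, hq]
          linarith
    rw [intervalIntegral.integral_add intervalIntegrable_const iiq,
      intervalIntegral.integral_const, sub_sub_cancel, smul_eq_mul] at hF
    have hcross : ‖dθ t‖ * ‖θ (t - τ)‖ + ‖θ t‖ * ‖dθ (t - τ)‖
        ≤ |κ| * τ * (4 * μ * τ * ‖dθ t‖ ^ 2 + 1 / 16 * ‖θ (t - τ)‖ ^ 2 + 1 / 16 * ‖θ t‖ ^ 2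
          + 4 * μ * τ * ‖dθ (t - τ)‖ ^ 2) := by
      have d1 : ‖dθ t‖ * ‖θ (t - τ)‖ ≤ (|κ| * τ * (4 * μ * τ)) * ‖dθ t‖ ^ 2
          + (|κ| * τ * (1 / 16)) * ‖θ (t - τ)‖ ^ 2 :=
        mul_le_young (by positivity) (by nlinarith)
      have d2 : ‖θ t‖ * ‖dθ (t - τ)‖ ≤ (|κ| * τ * (1 / 16)) * ‖θ t‖ ^ 2
          + (|κ| * τ * (4 * μ * τ)) * ‖dθ (t - τ)‖ ^ 2 :=
        mul_le_young (by positivity) (by nlinarith)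
      linarith
    have hfin : |κ| * τ * ‖θ t‖ ^ 2 ≤ |κ| * τ * ((4 * μ * τ * ‖dθ t‖ ^ 2
        + 1 / 16 * ‖θ (t - τ)‖ ^ 2 + 1 / 16 * ‖θ t‖ ^ 2 + 4 * μ * τ * ‖dθ (t - τ)‖ ^ 2)
        + (τ * P + ∫ s in (t - τ)..t, q s)) := by
      rw [mul_add (|κ| * τ)]
      exact ht.trans (add_le_add hcross (mul_le_mul_of_nonneg_left hF hx.le))
    have hfin' := le_of_mul_le_mul_left hfin hx
    refine hfin'.trans_eq ?_
    rw [hP]; field_simp; ring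
  obtain ⟨i5, e5⟩ := integral_linearCombination_four i1 i2 s1 s3
    (1 / 16 + τ * (μ * κ ^ 2 / 2) + 3 / 16) (4 * μ * τ + τ * μ) (1 / 16) (4 * μ * τ)
  have hint := integral_mono_ae i1 (i5.add w1) point
  simp only [Pi.add_apply] at hint
  rw [integral_add i5 w1, e5] at hint
  have hqint := (integral_linearCombination_four i1 i2 i3 i4
    (μ * κ ^ 2 / 2) (9 / 2 * μ) (4 * τ * κ ^ 2) (9 / 2 * μ⁻¹)).2
  rw [hq, hqint] at w2
  have s4' := mul_le_mul_of_nonneg_left s4 (show 0 ≤ 4 * μ * τ by positivity)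
  linarith

/-- Enhanced dissipation and energy bound for `κ ≠ 0`. -/
theorem IsShearEvolution.estimate (hV : IsClosed (V : Set (E × E)))
    (hY : IsSelfAdjoint Y) (hYV : ∀ p ∈ V, (Y p.1, p.1 + Y p.2) ∈ V)
    (hparts : ∀ p ∈ V, ∀ q ∈ V, inner ℂ p.2 q.1 + inner ℂ p.1 q.2 = 0)
    (H : IsShearEvolution V Y μ κ θ dθ g₁ g₂) (hμ : 0 < μ) (hκ : κ ≠ 0) {τ : ℝ} (hτ : 0 < τ)
    (hscale : μ * κ ^ 2 * τ ^ 3 = 1) :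
    (∀ T, τ⁻¹ * (∫ t in Iio T, ‖θ t‖ ^ 2) ≤ 2000 * (τ * κ ^ 2 * (∫ t in Iio T, ‖g₁ t‖ ^ 2)
      + μ⁻¹ * ∫ t in Iio T, ‖g₂ t‖ ^ 2)) ∧
    ∀ᵐ T : ℝ, ‖θ T‖ ^ 2 ≤ 2000 * (τ * κ ^ 2 * (∫ t in Iio T, ‖g₁ t‖ ^ 2)
      + μ⁻¹ * ∫ t in Iio T, ‖g₂ t‖ ^ 2) := by
  obtain ⟨en1, en2⟩ := H.isWeakEvolution.energy_le
  -- The `1/64` makes the absorption work: removing `27/2 μ ∫ ‖dθ‖²` takes 27 times the energy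
  -- inequality, which costs `27/64 τ⁻¹ ∫ ‖θ‖²`, less than the available `11/16`.
  have hre := fun T => H.integral_re_le hY (c₁ := 1 / 64 * τ⁻¹ - μ * κ ^ 2) (c₂ := -(μ / 2))
    (c₃ := 16 * τ * κ ^ 2) (c₄ := 1 / 2 * μ⁻¹) (fun t => by
      have d1 : (|κ| * ‖g₁ t‖) * ‖θ t‖ ≤ 16 * τ * (|κ| * ‖g₁ t‖) ^ 2
          + 1 / 64 * τ⁻¹ * ‖θ t‖ ^ 2 :=
        mul_le_young (by positivity) (by field_simp; norm_num)
      have d2 : ‖g₂ t‖ * ‖dθ t‖ ≤ 1 / 2 * μ⁻¹ * ‖g₂ t‖ ^ 2 + μ / 2 * ‖dθ t‖ ^ 2 :=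
        mul_le_young (by positivity) (by field_simp; norm_num)
      rw [mul_pow, sq_abs] at d1
      linarith) T
  have nonneg : ∀ (f : ℝ → E) T, 0 ≤ ∫ t in Iio T, ‖f t‖ ^ 2 := fun f T =>
    integral_nonneg fun t => by positivity
  have first : ∀ T, τ⁻¹ * (∫ t in Iio T, ‖θ t‖ ^ 2)
      ≤ 2000 * (τ * κ ^ 2 * (∫ t in Iio T, ‖g₁ t‖ ^ 2) + μ⁻¹ * ∫ t in Iio T, ‖g₂ t‖ ^ 2) := by
    intro T
    have h1 := H.integral_norm_sq_le hV hY hYV hparts hμ hκ hτ hscale T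
    have h2 := (en1 T).trans (hre T)
    have h3 : 11 / 16 * (τ⁻¹ * (∫ t in Iio T, ‖θ t‖ ^ 2))
        ≤ 27 / 2 * μ * (∫ t in Iio T, ‖dθ t‖ ^ 2)
      + μ * κ ^ 2 * (∫ t in Iio T, ‖θ t‖ ^ 2) + 4 * τ * κ ^ 2 * (∫ t in Iio T, ‖g₁ t‖ ^ 2)
      + 9 / 2 * μ⁻¹ * ∫ t in Iio T, ‖g₂ t‖ ^ 2 := by
      have := mul_le_mul_of_nonneg_left h1 (inv_nonneg.2 hτ.le)
      rw [inv_mul_cancel_left₀ hτ.ne'] at this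
      linarith
    have p1 : 0 ≤ μ * κ ^ 2 * (∫ t in Iio T, ‖θ t‖ ^ 2) := mul_nonneg (by positivity) (nonneg _ _)
    have p2 : 0 ≤ τ * κ ^ 2 * (∫ t in Iio T, ‖g₁ t‖ ^ 2) := mul_nonneg (by positivity) (nonneg _ _)
    have p3 : 0 ≤ μ⁻¹ * (∫ t in Iio T, ‖g₂ t‖ ^ 2) := mul_nonneg (by positivity) (nonneg _ _)
    linarith
  refine ⟨first, ?_⟩
  filter_upwards [en2] with T hT
  have h1 := hre T
  have h2 := first T
  have p0 : 0 ≤ μ * (∫ t in Iio T, ‖dθ t‖ ^ 2) := mul_nonneg hμ.le (nonneg _ _)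
  have p1 : 0 ≤ μ * κ ^ 2 * (∫ t in Iio T, ‖θ t‖ ^ 2) := mul_nonneg (by positivity) (nonneg _ _)
  have p2 : 0 ≤ τ * κ ^ 2 * (∫ t in Iio T, ‖g₁ t‖ ^ 2) := mul_nonneg (by positivity) (nonneg _ _)
  have p3 : 0 ≤ μ⁻¹ * (∫ t in Iio T, ‖g₂ t‖ ^ 2) := mul_nonneg (by positivity) (nonneg _ _)
  linarith

/-- Energy bound for `κ = 0`. -/
theorem IsShearEvolution.estimate_zero (hY : IsSelfAdjoint Y)
    (H : IsShearEvolution V Y μ 0 θ dθ g₁ g₂) (hμ : 0 < μ) :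
    ∀ᵐ T : ℝ, ‖θ T‖ ^ 2 ≤ μ⁻¹ * ∫ t in Iio T, ‖g₂ t‖ ^ 2 := by
  filter_upwards [H.isWeakEvolution.energy_le.2] with T hT
  have := H.integral_re_le hY (c₁ := 0) (c₂ := 0) (c₃ := 0) (c₄ := 1 / 2 * μ⁻¹) (fun t => by
    have d2 : ‖g₂ t‖ * ‖dθ t‖ ≤ 1 / 2 * μ⁻¹ * ‖g₂ t‖ ^ 2 + μ / 2 * ‖dθ t‖ ^ 2 :=
      mul_le_young (by positivity) (by field_simp; norm_num)
    have : 0 ≤ μ / 2 * ‖dθ t‖ ^ 2 := by positivity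
    simp only [abs_zero]
    linarith) T
  linarith

end ShearEstimate

/-! ### The space `L²(-1, 1)`, the graph of `H^1_0` and multiplication by `y`. -/

section Channel

open Filter Topology

instance : IsFiniteMeasure channelMeasure := by unfold channelMeasure; infer_instance

/-- The Hilbert space `L²(-1, 1)`. -/
abbrev ChannelL2 := Lp ℂ 2 channelMeasure

theorem integral_channel_eq_intervalIntegral {F : Type*} [NormedAddCommGroup F] [NormedSpace ℝ F]
    (f : ℝ → F) : ∫ y, f y ∂channelMeasure = ∫ y in (-1 : ℝ)..1, f y := by
  rw [channelMeasure, intervalIntegral.integral_of_le (by norm_num), integral_Ioc_eq_integral_Ioo]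

theorem ae_channel_imp {p : ℝ → Prop} (h : ∀ᵐ y ∂channelMeasure, p y) :
    ∀ᵐ y : ℝ, y ∈ Ioc (-1 : ℝ) 1 → p y := by
  rw [channelMeasure, ae_restrict_iff' measurableSet_Ioo] at h
  have h1 : ∀ᵐ y : ℝ, y ≠ 1 := by simp [ae_iff, measure_singleton]
  filter_upwards [h, h1] with y hy h1 hy2
  exact hy ⟨hy2.1, lt_of_le_of_ne hy2.2 h1⟩

theorem primitive_congr {f g : ℝ → ℂ} (h : f =ᵐ[channelMeasure] g) {y : ℝ}
    (hy : y ∈ Icc (-1 : ℝ) 1) : ∫ z in (-1 : ℝ)..y, f z = ∫ z in (-1 : ℝ)..y, g z := by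
  refine intervalIntegral.integral_congr_ae ?_
  filter_upwards [ae_channel_imp h] with z hz hz'
  rw [uIoc_of_le hy.1] at hz'
  exact hz ⟨hz'.1, hz'.2.trans hy.2⟩

theorem intervalIntegrable_of_memLp_channel {f : ℝ → ℂ} (h : MemLp f 2 channelMeasure) {y : ℝ}
    (hy : y ∈ Icc (-1 : ℝ) 1) : IntervalIntegrable f volume (-1) y := by
  have hi : Integrable f channelMeasure := h.integrable (by norm_num)
  have hi' : IntegrableOn f (Ioc (-1) 1) := by
    rw [integrableOn_Ioc_iff_integrableOn_Ioo]; exact hi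
  rw [intervalIntegrable_iff_integrableOn_Ioc_of_le hy.1]
  exact hi'.mono_set (Ioc_subset_Ioc_right hy.2)

theorem ae_mem_channel : ∀ᵐ y ∂channelMeasure, y ∈ Ioo (-1 : ℝ) 1 :=
  ae_restrict_mem measurableSet_Ioo

namespace IsH10

variable {u du w dw : ℝ → ℂ}

theorem congr (h : IsH10 u du) {u' du' : ℝ → ℂ} (hu : u =ᵐ[channelMeasure] u')
    (hd : du =ᵐ[channelMeasure] du') : IsH10 u' du' where
  memLp_deriv := (memLp_congr_ae hd).1 h.memLp_deriv
  ae_eq_integral := by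
    filter_upwards [h.ae_eq_integral, hu, ae_mem_channel] with y h1 h2 h3
    rw [← h2, h1, primitive_congr hd (Ioo_subset_Icc_self h3)]
  integral_eq_zero := by
    rw [← primitive_congr hd (by simp), h.integral_eq_zero]

theorem zero : IsH10 0 0 where
  memLp_deriv := MemLp.zero
  ae_eq_integral := by simp
  integral_eq_zero := by simp

theorem add (h : IsH10 u du) (h' : IsH10 w dw) : IsH10 (u + w) (du + dw) where
  memLp_deriv := h.memLp_deriv.add h'.memLp_deriv
  ae_eq_integral := by
    filter_upwards [h.ae_eq_integral, h'.ae_eq_integral, ae_mem_channel] with y h1 h2 h3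
    have h3 := Ioo_subset_Icc_self h3
    simp only [Pi.add_apply]
    rw [intervalIntegral.integral_add (intervalIntegrable_of_memLp_channel h.memLp_deriv h3)
      (intervalIntegrable_of_memLp_channel h'.memLp_deriv h3), h1, h2]
  integral_eq_zero := by
    simp only [Pi.add_apply]
    rw [intervalIntegral.integral_add
      (intervalIntegrable_of_memLp_channel h.memLp_deriv (by simp))
      (intervalIntegrable_of_memLp_channel h'.memLp_deriv (by simp)),
      h.integral_eq_zero, h'.integral_eq_zero, add_zero]

theorem const_smul (c : ℂ) (h : IsH10 u du) : IsH10 (c • u) (c • du) where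
  memLp_deriv := h.memLp_deriv.const_smul c
  ae_eq_integral := by
    filter_upwards [h.ae_eq_integral] with y h1
    simp only [Pi.smul_apply, intervalIntegral.integral_smul, h1]
  integral_eq_zero := by
    simp only [Pi.smul_apply, intervalIntegral.integral_smul, h.integral_eq_zero, smul_zero]

theorem memLp_coord_mul {f : ℝ → ℂ} (hf : MemLp f 2 channelMeasure) :
    MemLp (fun y : ℝ => (y : ℂ) * f y) 2 channelMeasure := by
  refine hf.of_le (Complex.measurable_ofReal.aestronglyMeasurable.mul hf.1) ?_
  filter_upwards [ae_mem_channel] with y hy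
  rw [norm_mul, Complex.norm_real, Real.norm_eq_abs]
  exact mul_le_of_le_one_left (norm_nonneg _) (abs_le.2 ⟨hy.1.le, hy.2.le⟩)

theorem coord_mul (h : IsH10 u du) (hu : MemLp u 2 channelMeasure) :
    IsH10 (fun y : ℝ => (y : ℂ) * u y) (fun y : ℝ => u y + (y : ℂ) * du y) := by
  have key : ∀ y ∈ Icc (-1 : ℝ) 1, ∫ z in (-1 : ℝ)..y, (u z + (z : ℂ) * du z)
      = (y : ℂ) * ∫ z in (-1 : ℝ)..y, du z := by
    intro y hy
    have hi := intervalIntegrable_of_memLp_channel h.memLp_deriv hy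
    have hi2 := intervalIntegrable_of_memLp_channel (memLp_coord_mul h.memLp_deriv) hy
    have hi3 := intervalIntegrable_of_memLp_channel hu hy
    -- The product rule is integration by parts against the constant `1`, whose primitive from `-1`
    -- is `y + 1`; the surplus `∫ du` cancels at the end.
    have e := intervalIntegral_bilin_primitive (ContinuousLinearMap.mul ℝ ℂ) hy.1
      (intervalIntegrable_const (c := (1 : ℂ))) hi
    have hone : ∀ s : ℝ, ∫ _ in (-1 : ℝ)..s, (1 : ℂ) = (s : ℂ) + 1 := fun s => by
      simp
    simp only [hone, ContinuousLinearMap.mul_apply', one_mul] at e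
    have e2 : ∫ s in (-1 : ℝ)..y, ((∫ r in (-1 : ℝ)..s, du r) + ((s : ℂ) + 1) * du s)
        = ∫ z in (-1 : ℝ)..y, ((u z + (z : ℂ) * du z) + du z) := by
      refine intervalIntegral.integral_congr_ae ?_
      filter_upwards [ae_channel_imp h.ae_eq_integral] with z hz hz'
      rw [uIoc_of_le hy.1] at hz'
      rw [hz ⟨hz'.1, hz'.2.trans hy.2⟩]
      ring
    rw [e2, intervalIntegral.integral_add (hi3.add hi2) hi] at e
    linear_combination e
  refine ⟨hu.add (memLp_coord_mul h.memLp_deriv), ?_, ?_⟩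
  · filter_upwards [h.ae_eq_integral, ae_mem_channel] with y h1 h2
    rw [key y (Ioo_subset_Icc_self h2), h1]
  · rw [key 1 (by simp), h.integral_eq_zero, mul_zero]

theorem integral_parts (h : IsH10 u du) (h' : IsH10 w dw) :
    ∫ y, (inner ℂ (du y) (w y) + inner ℂ (u y) (dw y)) ∂channelMeasure = 0 := by
  have e := intervalIntegral_inner_primitive (E := ℂ) (by norm_num : (-1 : ℝ) ≤ 1)
    (intervalIntegrable_of_memLp_channel h.memLp_deriv (by simp))
    (intervalIntegrable_of_memLp_channel h'.memLp_deriv (by simp))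
  rw [h.integral_eq_zero, inner_zero_left, ← integral_channel_eq_intervalIntegral] at e
  rw [← e]
  refine integral_congr_ae ?_
  filter_upwards [h.ae_eq_integral, h'.ae_eq_integral] with y h1 h2
  rw [h1, h2]

end IsH10

/-- Shows that the primitive at a fixed point depends continuously on `d` in `L²`, which gives
closedness of the graph. -/
theorem primitive_eq_inner (d : ChannelL2) {y : ℝ} (hy : y ∈ Icc (-1 : ℝ) 1) :
    ∫ z in (-1 : ℝ)..y, d z = inner ℂ (indicatorConstLp 2 (measurableSet_Iio (a := y))
      (measure_ne_top channelMeasure _) (1 : ℂ)) d := by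
  have hr : channelMeasure.restrict (Iio y) = volume.restrict (Ioo (-1) y) := by
    rw [channelMeasure, Measure.restrict_restrict measurableSet_Iio]
    congr 1
    ext z
    simp only [mem_Ioo, mem_inter_iff, mem_Iio]
    exact ⟨fun h => ⟨h.2.1, h.1⟩, fun h => ⟨h.2, h.1, h.2.trans_le hy.2⟩⟩
  rw [L2.inner_indicatorConstLp_one, hr, intervalIntegral.integral_of_le hy.1,
    integral_Ioc_eq_integral_Ioo]

/-- The graph of the derivative on `H^1_0(-1, 1)`. -/
def h10Graph : Submodule ℂ (ChannelL2 × ChannelL2) where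
  carrier := {p | IsH10 p.1 p.2}
  zero_mem' := IsH10.zero.congr (Lp.coeFn_zero _ _ _).symm (Lp.coeFn_zero _ _ _).symm
  add_mem' := fun {p q} hp hq =>
    (IsH10.add hp hq).congr (Lp.coeFn_add p.1 q.1).symm (Lp.coeFn_add p.2 q.2).symm
  smul_mem' := fun c p hp =>
    (IsH10.const_smul c hp).congr (Lp.coeFn_smul c p.1).symm (Lp.coeFn_smul c p.2).symm

theorem mem_h10Graph {p : ChannelL2 × ChannelL2} : p ∈ h10Graph ↔ IsH10 p.1 p.2 := Iff.rfl

/-- Primitives converge at every point by `primitive_eq_inner`, and the functions converge almost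
everywhere along a subsequence, so both defining identities pass to the limit. -/
theorem isClosed_h10Graph : IsClosed (h10Graph : Set (ChannelL2 × ChannelL2)) := by
  refine IsSeqClosed.isClosed fun x p hx hp => ?_
  have hp1 : Tendsto (fun n => (x n).1) atTop (𝓝 p.1) := (continuous_fst.tendsto p).comp hp
  have hp2 : Tendsto (fun n => (x n).2) atTop (𝓝 p.2) := (continuous_snd.tendsto p).comp hp
  have hprim : ∀ y ∈ Icc (-1 : ℝ) 1, Tendsto (fun n => ∫ z in (-1 : ℝ)..y, (x n).2 z) atTop
      (𝓝 (∫ z in (-1 : ℝ)..y, p.2 z)) := by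
    intro y hy
    simp only [primitive_eq_inner _ hy]
    exact tendsto_const_nhds.inner hp2
  refine mem_h10Graph.2 ⟨Lp.memLp _, ?_, ?_⟩
  · obtain ⟨ns, hns, hae⟩ := (tendstoInMeasure_of_tendsto_Lp hp1).exists_seq_tendsto_ae
    have hall : ∀ᵐ y ∂channelMeasure, ∀ n, (x n).1 y = ∫ z in (-1 : ℝ)..y, (x n).2 z :=
      ae_all_iff.2 fun n => (mem_h10Graph.1 (hx n)).ae_eq_integral
    filter_upwards [hae, hall, ae_mem_channel] with y h1 h2 h3
    refine tendsto_nhds_unique h1 ?_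
    simp only [h2]
    exact (hprim y (Ioo_subset_Icc_self h3)).comp hns.tendsto_atTop
  · refine tendsto_nhds_unique (hprim 1 (by simp)) ?_
    have : ∀ n, ∫ z in (-1 : ℝ)..1, (x n).2 z = 0 := fun n =>
      (mem_h10Graph.1 (hx n)).integral_eq_zero
    simp only [this]
    exact tendsto_const_nhds

theorem memLp_top_coord : MemLp (fun y : ℝ => (y : ℂ)) ∞ channelMeasure := by
  refine memLp_top_of_bound Complex.measurable_ofReal.aestronglyMeasurable 1 ?_
  filter_upwards [ae_mem_channel] with y hy
  rw [Complex.norm_real, Real.norm_eq_abs]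
  exact abs_le.2 ⟨hy.1.le, hy.2.le⟩

/-- Multiplication by the coordinate `y` on `L²(-1, 1)`. -/
def coordMul : ChannelL2 →L[ℂ] ChannelL2 :=
  (ContinuousLinearMap.mul ℂ ℂ).holderL channelMeasure ∞ 2 2 memLp_top_coord.toLp

theorem coeFn_coordMul (f : ChannelL2) :
    coordMul f =ᵐ[channelMeasure] fun y => (y : ℂ) * f y := by
  filter_upwards [(ContinuousLinearMap.mul ℂ ℂ).coeFn_holder (r := 2) memLp_top_coord.toLp f,
    memLp_top_coord.coeFn_toLp] with y h1 h2
  rw [coordMul, ContinuousLinearMap.holderL_apply_apply, h1, h2]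
  rfl

theorem isSelfAdjoint_coordMul : IsSelfAdjoint coordMul := by
  rw [ContinuousLinearMap.isSelfAdjoint_iff_isSymmetric]
  intro f g
  rw [ContinuousLinearMap.coe_coe, L2.inner_def, L2.inner_def]
  refine integral_congr_ae ?_
  filter_upwards [coeFn_coordMul f, coeFn_coordMul g] with y h1 h2
  rw [h1, h2]
  simp only [RCLike.inner_apply, map_mul, Complex.conj_ofReal]
  ring

theorem coordMul_mem_h10Graph (p : ChannelL2 × ChannelL2) (hp : p ∈ h10Graph) :
    (coordMul p.1, p.1 + coordMul p.2) ∈ h10Graph := by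
  refine mem_h10Graph.2 ((IsH10.coord_mul hp (Lp.memLp p.1)).congr (coeFn_coordMul p.1).symm ?_)
  filter_upwards [coeFn_coordMul p.2, Lp.coeFn_add p.1 (coordMul p.2)] with y h1 h2
  rw [h2, Pi.add_apply, h1]

theorem h10Graph_parts (p : ChannelL2 × ChannelL2) (hp : p ∈ h10Graph)
    (q : ChannelL2 × ChannelL2) (hq : q ∈ h10Graph) :
    inner ℂ p.2 q.1 + inner ℂ p.1 q.2 = 0 := by
  rw [L2.inner_def, L2.inner_def, ← integral_add (L2.integrable_inner _ _)
    (L2.integrable_inner _ _)]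
  exact IsH10.integral_parts hp hq

end Channel

/-! ### From functions of `(t, y)` to curves in `L²(-1, 1)`. -/

section Slices

open Filter Topology

/-- Pairing with a dense sequence embeds `E` continuously and injectively into `ℕ → ℂ`; between such
Polish spaces this is a measurable embedding, by Lusin–Souslin. -/
theorem measurable_of_inner {X E : Type*} [MeasurableSpace X] [NormedAddCommGroup E]
    [InnerProductSpace ℂ E] [CompleteSpace E] [SecondCountableTopology E] [MeasurableSpace E]
    [BorelSpace E] {f : X → E} (h : ∀ v : E, Measurable fun x => inner ℂ v (f x)) :
    Measurable f := by
  let ι : E → ℕ → ℂ := fun x n => inner ℂ (TopologicalSpace.denseSeq E n) x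
  have hc : Continuous ι := continuous_pi fun n => by fun_prop
  have hinj : Function.Injective ι := by
    intro x y hxy
    refine ext_inner_left ℂ fun v => ?_
    refine (TopologicalSpace.denseRange_denseSeq E).induction_on
      (p := fun v => inner ℂ v x = inner ℂ v y) v (isClosed_eq (by fun_prop) (by fun_prop))
      fun n => congrFun hxy n
  rw [← (hc.measurableEmbedding hinj).measurable_comp_iff]
  exact measurable_pi_lambda _ fun n => h _

instance : SecondCountableTopology ChannelL2 :=
  have : Fact ((2 : ℝ≥0∞) ≠ ∞) := ⟨by norm_num⟩
  inferInstance

open Classical in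
/-- The time slice `f t` as an element of `L²(-1, 1)`. -/
def sliceL2 (f : ℝ → ℝ → ℂ) (t : ℝ) : ChannelL2 :=
  if h : MemLp (f t) 2 channelMeasure then h.toLp else 0

theorem coeFn_sliceL2 {f : ℝ → ℝ → ℂ} {t : ℝ} (h : MemLp (f t) 2 channelMeasure) :
    sliceL2 f t =ᵐ[channelMeasure] f t := by
  rw [sliceL2, dif_pos h]
  exact h.coeFn_toLp

theorem sliceL2_congr {f g : ℝ → ℝ → ℂ} {t : ℝ} (h : f t =ᵐ[channelMeasure] g t) :
    sliceL2 f t = sliceL2 g t := by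
  by_cases hf : MemLp (f t) 2 channelMeasure
  · have hg := (memLp_congr_ae h).1 hf
    rw [sliceL2, sliceL2, dif_pos hf, dif_pos hg]
    exact MemLp.toLp_congr hf hg h
  · have hg : ¬ MemLp (g t) 2 channelMeasure := fun hg => hf ((memLp_congr_ae h).2 hg)
    rw [sliceL2, sliceL2, dif_neg hf, dif_neg hg]

theorem measurable_sliceL2 [MeasurableSpace ChannelL2] [BorelSpace ChannelL2] {f : ℝ → ℝ → ℂ}
    (hf : StronglyMeasurable (Function.uncurry f)) : Measurable (sliceL2 f) := by
  have hft : ∀ t, StronglyMeasurable (f t) := fun t => hf.comp_measurable measurable_prodMk_left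
  have hset : MeasurableSet {t | MemLp (f t) 2 channelMeasure} := by
    have hm : Measurable fun t => ∫⁻ y, ‖f t y‖ₑ ^ (2 : ℝ) ∂channelMeasure :=
      (hf.measurable.enorm.pow_const 2).lintegral_prod_right'
    have : {t | MemLp (f t) 2 channelMeasure}
        = {t | ∫⁻ y, ‖f t y‖ₑ ^ (2 : ℝ) ∂channelMeasure < ∞} := by
      ext t
      have h2 := eLpNorm_lt_top_iff_lintegral_rpow_enorm_lt_top (f := f t) (μ := channelMeasure)
        (p := 2) (by norm_num) (by norm_num)
      simp only [ENNReal.toReal_ofNat] at h2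
      exact ⟨fun h => h2.1 h.2, fun h => ⟨(hft t).aestronglyMeasurable, h2.2 h⟩⟩
    rw [this]
    exact measurableSet_lt hm measurable_const
  refine measurable_of_inner fun v => ?_
  have hv : StronglyMeasurable (v : ℝ → ℂ) := Lp.stronglyMeasurable v
  have hint : StronglyMeasurable fun t => ∫ y, inner ℂ (v y) (f t y) ∂channelMeasure := by
    have : StronglyMeasurable fun p : ℝ × ℝ => inner ℂ (v p.2) (Function.uncurry f p) :=
      (hv.comp_measurable measurable_snd).inner hf
    exact this.integral_prod_right'
  -- Times with a slice outside `L²` carry the default value `0`, hence the indicator of a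
  -- measurable set.
  have heq : (fun t => inner ℂ v (sliceL2 f t)) = {t | MemLp (f t) 2 channelMeasure}.indicator
      fun t => ∫ y, inner ℂ (v y) (f t y) ∂channelMeasure := by
    funext t
    by_cases h : MemLp (f t) 2 channelMeasure
    · rw [indicator_of_mem (show t ∈ {t | MemLp (f t) 2 channelMeasure} from h), L2.inner_def]
      refine integral_congr_ae ?_
      filter_upwards [coeFn_sliceL2 h] with y hy
      rw [hy]
    · rw [indicator_of_notMem (show t ∉ {t | MemLp (f t) 2 channelMeasure} from h), sliceL2,
        dif_neg h, inner_zero_right]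
  rw [heq]
  exact hint.measurable.indicator hset

variable {ν : Measure ℝ} [SFinite ν] {f : ℝ → ℝ → ℂ}

theorem ae_memLp_slice (hf : MemLp (Function.uncurry f) 2 (ν.prod channelMeasure)) :
    ∀ᵐ t ∂ν, MemLp (f t) 2 channelMeasure := by
  have h1 : ∀ᵐ t ∂ν, AEStronglyMeasurable (f t) channelMeasure := hf.1.prodMk_left
  have h2 := ((memLp_two_iff_integrable_sq_norm hf.1).1 hf).prod_right_ae
  filter_upwards [h1, h2] with t h1 h2
  exact (memLp_two_iff_integrable_sq_norm h1).2 h2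

/-- Measurability is obtained from a strongly measurable representative, which has the same slices
for almost every time; integrability of the squared norm is Fubini. -/
theorem memLp_sliceL2 (hf : MemLp (Function.uncurry f) 2 (ν.prod channelMeasure)) :
    MemLp (sliceL2 f) 2 ν := by
  let : MeasurableSpace ChannelL2 := borel _
  have : BorelSpace ChannelL2 := ⟨rfl⟩
  have hm : AEStronglyMeasurable (sliceL2 f) ν := by
    set F : ℝ × ℝ → ℂ := hf.1.mk (Function.uncurry f) with hF
    have hFm : StronglyMeasurable (Function.uncurry fun t y => F (t, y)) :=
      hf.1.stronglyMeasurable_mk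
    refine ⟨sliceL2 fun t y => F (t, y), (measurable_sliceL2 hFm).stronglyMeasurable, ?_⟩
    filter_upwards [Measure.ae_ae_of_ae_prod hf.1.ae_eq_mk] with t ht
    exact sliceL2_congr ht
  rw [memLp_two_iff_integrable_sq_norm hm]
  have h2 := ((memLp_two_iff_integrable_sq_norm hf.1).1 hf).integral_prod_left
  refine h2.congr ?_
  filter_upwards [ae_memLp_slice hf] with t ht
  have h3 : ((‖sliceL2 f t‖ ^ 2 : ℝ) : ℂ) = inner ℂ (sliceL2 f t) (sliceL2 f t) := by
    rw [inner_self_eq_norm_sq_to_K]; push_cast; rfl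
  have h4 : inner ℂ (sliceL2 f t) (sliceL2 f t)
      = ∫ y, ((‖f t y‖ ^ 2 : ℝ) : ℂ) ∂channelMeasure := by
    rw [L2.inner_def]
    refine integral_congr_ae ?_
    filter_upwards [coeFn_sliceL2 ht] with y hy
    rw [hy, inner_self_eq_norm_sq_to_K]; push_cast; rfl
  rw [h4, integral_complex_ofReal] at h3
  exact (Complex.ofReal_injective h3).symm

theorem mixedNorm_eq_eLpNorm_sliceL2 {p : ℝ≥0∞}
    (hf : ∀ᵐ t ∂timeMeasure, MemLp (f t) 2 channelMeasure) :
    mixedNorm p 2 f = eLpNorm (sliceL2 f) p timeMeasure := by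
  refine eLpNorm_congr_enorm_ae ?_
  filter_upwards [hf] with t ht
  rw [sliceL2, dif_pos ht, Lp.enorm_toLp, enorm_eq_self]

theorem inner_sliceL2 (v : ChannelL2) {t : ℝ} (ht : MemLp (f t) 2 channelMeasure) :
    inner ℂ v (sliceL2 f t) = innerY (f t) v := by
  rw [L2.inner_def, innerY]
  refine integral_congr_ae ?_
  filter_upwards [coeFn_sliceL2 ht] with y hy
  rw [hy, RCLike.inner_apply]

theorem inner_coordMul_sliceL2 (v : ChannelL2) {t : ℝ} (ht : MemLp (f t) 2 channelMeasure) :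
    inner ℂ v (coordMul (sliceL2 f t)) = innerY (fun y => (y : ℂ) * f t y) v := by
  rw [L2.inner_def, innerY]
  refine integral_congr_ae ?_
  filter_upwards [coeFn_sliceL2 ht, coeFn_coordMul (sliceL2 f t)] with y hy hy2
  rw [hy2, hy, RCLike.inner_apply]

end Slices

/-! ### Transfer to the abstract setting and conclusion. -/

section Main

open Filter Topology

theorem memLp_shearLower {E : Type*} [NormedAddCommGroup E] [InnerProductSpace ℂ E]
    [CompleteSpace E] {μ κ : ℝ} (Y : E →L[ℂ] E) {θ g : ℝ → E} {ν : Measure ℝ} (hθ : MemLp θ 2 ν)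
    (hg : MemLp g 2 ν) : MemLp (shearLower μ κ Y θ g) 2 ν :=
  (((hθ.const_smul _).add ((Y.comp_memLp' hθ).const_smul _)).add (hg.const_smul _)).neg

theorem memLp_shearFlux {E : Type*} [NormedAddCommGroup E] [InnerProductSpace ℂ E]
    [CompleteSpace E] {μ : ℝ} {dθ g : ℝ → E} {ν : Measure ℝ} (hθ : MemLp dθ 2 ν)
    (hg : MemLp g 2 ν) : MemLp (shearFlux μ dθ g) 2 ν :=
  hg.sub (hθ.const_smul _)

/-- The curve of time slices, extended by zero to negative times. -/
def sliceCurve (f : ℝ → ℝ → ℂ) : ℝ → ChannelL2 := (Ioi 0).indicator (sliceL2 f)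

theorem sliceCurve_of_pos {f : ℝ → ℝ → ℂ} {t : ℝ} (ht : 0 < t) : sliceCurve f t = sliceL2 f t :=
  indicator_of_mem (show t ∈ Ioi 0 from ht) _

theorem sliceCurve_of_nonpos {f : ℝ → ℝ → ℂ} {t : ℝ} (ht : t ≤ 0) : sliceCurve f t = 0 :=
  indicator_of_notMem (show t ∉ Ioi 0 from not_lt.2 ht) _

theorem memLp_sliceCurve {f : ℝ → ℝ → ℂ} (hf : ∀ T : ℝ, 0 < T →
    MemLp (Function.uncurry f) 2 ((volume.restrict (Ioo 0 T)).prod channelMeasure)) (T : ℝ) :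
    MemLp (sliceCurve f) 2 (volume.restrict (Iio T)) := by
  rw [sliceCurve, memLp_indicator_iff_restrict measurableSet_Ioi,
    Measure.restrict_restrict measurableSet_Ioi, Ioi_inter_Iio]
  -- The hypothesis covers positive times only; `max T 1` handles every real `T`.
  refine (memLp_sliceL2 (hf (max T 1) (by positivity))).mono_measure
    (Measure.restrict_mono (Ioo_subset_Ioo_right (le_max_left _ _)) le_rfl)

theorem ae_memLp_slice_of_local {f : ℝ → ℝ → ℂ} (hf : ∀ T : ℝ, 0 < T →
    MemLp (Function.uncurry f) 2 ((volume.restrict (Ioo 0 T)).prod channelMeasure)) :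
    ∀ᵐ t : ℝ, 0 < t → MemLp (f t) 2 channelMeasure := by
  have h : ∀ᵐ t : ℝ, ∀ n : ℕ, t ∈ Ioo (0 : ℝ) (n + 1) → MemLp (f t) 2 channelMeasure :=
    ae_all_iff.2 fun n => (ae_restrict_iff' measurableSet_Ioo).1
      (ae_memLp_slice (hf (n + 1) (by positivity)))
  filter_upwards [h] with t ht h0
  obtain ⟨n, hn⟩ := exists_nat_gt t
  exact ht n ⟨h0, hn.trans (by linarith)⟩

theorem memLp_local_of_memLp {f : ℝ → ℝ → ℂ}
    (hf : MemLp (Function.uncurry f) 2 (timeMeasure.prod channelMeasure)) (T : ℝ) :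
    MemLp (Function.uncurry f) 2 ((volume.restrict (Ioo 0 T)).prod channelMeasure) :=
  hf.mono_measure (Measure.prod_mono (Measure.restrict_mono Ioo_subset_Ioi_self le_rfl) le_rfl)

theorem memLp_sliceCurve_of_memLp {f : ℝ → ℝ → ℂ}
    (hf : MemLp (Function.uncurry f) 2 (timeMeasure.prod channelMeasure)) :
    MemLp (sliceCurve f) 2 volume := by
  rw [sliceCurve, memLp_indicator_iff_restrict measurableSet_Ioi]
  have : SFinite timeMeasure := by unfold timeMeasure; infer_instance
  exact memLp_sliceL2 (ν := timeMeasure) hf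

theorem mixedNorm_eq_eLpNorm_sliceCurve {f : ℝ → ℝ → ℂ} {p : ℝ≥0∞}
    (hf : ∀ᵐ t : ℝ, 0 < t → MemLp (f t) 2 channelMeasure) :
    mixedNorm p 2 f = eLpNorm (sliceCurve f) p volume := by
  rw [mixedNorm_eq_eLpNorm_sliceL2 ((ae_restrict_iff' measurableSet_Ioi).2 hf), sliceCurve,
    eLpNorm_indicator_eq_eLpNorm_restrict measurableSet_Ioi, timeMeasure]

/-- Moving diffusion and shear to the right-hand side gives the abstract form. Zero initial data
allow the extension by zero to negative times, so integrals over `Iio T` see only `(0, T)`. -/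
theorem isShearEvolution_of_isThetaISolution {μ : ℝ} {k : ℤ} {g₁ g₂ θ : ℝ → ℝ → ℂ}
    (hg₁ : MemLp (Function.uncurry g₁) 2 (timeMeasure.prod channelMeasure))
    (hg₂ : MemLp (Function.uncurry g₂) 2 (timeMeasure.prod channelMeasure))
    (hθ : IsThetaISolution μ k g₁ g₂ θ) :
    (∀ᵐ t : ℝ, 0 < t → MemLp (θ t) 2 channelMeasure) ∧
    ∃ dθ : ℝ → ChannelL2, IsShearEvolution h10Graph coordMul μ k (sliceCurve θ) dθ
      (sliceCurve g₁) (sliceCurve g₂) := by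
  obtain ⟨dθ, hmem, hH, hweak⟩ := hθ
  have hθL := memLp_sliceCurve fun T hT => (hmem T hT).1
  have hdL := memLp_sliceCurve fun T hT => (hmem T hT).2
  have hg₁L := memLp_sliceCurve fun T _ => memLp_local_of_memLp hg₁ T
  have hg₂L := memLp_sliceCurve fun T _ => memLp_local_of_memLp hg₂ T
  have aθ := ae_memLp_slice_of_local fun T hT => (hmem T hT).1
  have ad := ae_memLp_slice_of_local fun T hT => (hmem T hT).2
  have ag₁ := ae_memLp_slice_of_local fun T _ => memLp_local_of_memLp hg₁ T
  have ag₂ := ae_memLp_slice_of_local fun T _ => memLp_local_of_memLp hg₂ T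
  have hYL : ∀ T, MemLp (fun t => coordMul (sliceCurve θ t)) 2 (volume.restrict (Iio T)) :=
    fun T => coordMul.comp_memLp' (hθL T)
  refine ⟨aθ, sliceCurve dθ, ⟨?_, hg₁L, hg₂L⟩⟩
  refine ⟨hθL, hdL, fun T => ?_, fun T => ?_, fun t ht => sliceCurve_of_nonpos ht,
    fun t ht => ?_, fun t ht => ?_, ?_, fun p hp => ?_⟩
  · exact memLp_shearLower coordMul (hθL T) (hg₁L T)
  · exact memLp_shearFlux (hdL T) (hg₂L T)
  · simp [shearLower, sliceCurve_of_nonpos ht]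
  · simp [shearFlux, sliceCurve_of_nonpos ht]
  · filter_upwards [(ae_restrict_iff' measurableSet_Ioi).1 hH, aθ, ad] with t h1 h2 h3
    rcases le_or_gt t 0 with ht | ht
    · rw [sliceCurve_of_nonpos ht, sliceCurve_of_nonpos ht]
      exact h10Graph.zero_mem
    · rw [sliceCurve_of_pos ht, sliceCurve_of_pos ht, mem_h10Graph]
      exact (h1 ht).congr (coeFn_sliceL2 (h2 ht)).symm (coeFn_sliceL2 (h3 ht)).symm
  · filter_upwards [(ae_restrict_iff' measurableSet_Ioi).1 (hweak p.1 p.2 hp), aθ] with t ht h2 h0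
    have e := ht h0
    rw [← inner_sliceL2 p.1 (h2 h0), ← sliceCurve_of_pos h0] at e
    have ip : ∀ {f : ℝ → ChannelL2} (v : ChannelL2), (∀ T, MemLp f 2 (volume.restrict (Iio T))) →
        IntervalIntegrable (fun s => inner ℂ v (f s)) volume 0 t := fun v hf =>
      have hi := intervalIntegrable_of_memLp_Iio hf 0 t
      ⟨(innerSL ℂ v).integrable_comp hi.1, (innerSL ℂ v).integrable_comp hi.2⟩
    have e1 : ∫ s in (0 : ℝ)..t, ((μ : ℂ) * innerY (dθ s) p.2
          + (μ : ℂ) * (k : ℂ) ^ 2 * innerY (θ s) p.1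
          + Complex.I * (k : ℂ) * innerY (fun y => (y : ℂ) * θ s y) p.1)
        = ∫ s in (0 : ℝ)..t, ((μ : ℂ) * inner ℂ p.2 (sliceCurve dθ s)
          + (μ : ℂ) * (k : ℂ) ^ 2 * inner ℂ p.1 (sliceCurve θ s)
          + Complex.I * (k : ℂ) * inner ℂ p.1 (coordMul (sliceCurve θ s))) := by
      refine intervalIntegral.integral_congr_ae ?_
      filter_upwards [aθ, ad] with s hs1 hs2 hs
      rw [uIoc_of_le h0.le] at hs
      simp only [sliceCurve_of_pos hs.1, inner_sliceL2 _ (hs1 hs.1), inner_sliceL2 _ (hs2 hs.1),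
        inner_coordMul_sliceL2 _ (hs1 hs.1)]
    have e2 : ∫ s in (0 : ℝ)..t, (-(Complex.I * (k : ℂ) * innerY (g₁ s) p.1)
          + innerY (g₂ s) p.2)
        = ∫ s in (0 : ℝ)..t, (-(Complex.I * (k : ℂ) * inner ℂ p.1 (sliceCurve g₁ s))
          + inner ℂ p.2 (sliceCurve g₂ s)) := by
      refine intervalIntegral.integral_congr_ae ?_
      filter_upwards [ag₁, ag₂] with s hs1 hs2 hs
      rw [uIoc_of_le h0.le] at hs
      simp only [sliceCurve_of_pos hs.1, inner_sliceL2 _ (hs1 hs.1), inner_sliceL2 _ (hs2 hs.1)]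
    have j1 : IntervalIntegrable (fun s => (μ : ℂ) * inner ℂ p.2 (sliceCurve dθ s)
          + (μ : ℂ) * (k : ℂ) ^ 2 * inner ℂ p.1 (sliceCurve θ s)
          + Complex.I * (k : ℂ) * inner ℂ p.1 (coordMul (sliceCurve θ s))) volume 0 t :=
      (((ip p.2 hdL).const_mul _).add ((ip p.1 hθL).const_mul _)).add ((ip p.1 hYL).const_mul _)
    have j2 : IntervalIntegrable (fun s => -(Complex.I * (k : ℂ) * inner ℂ p.1 (sliceCurve g₁ s))
          + inner ℂ p.2 (sliceCurve g₂ s)) volume 0 t :=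
      ((ip p.1 hg₁L).const_mul _).neg.add (ip p.2 hg₂L)
    rw [e1, e2, ← eq_sub_iff_add_eq, ← intervalIntegral.integral_sub j2 j1] at e
    rw [e]
    refine intervalIntegral.integral_congr fun s _ => ?_
    simp only [shearLower, shearFlux, inner_neg_right, inner_add_right, inner_sub_right,
      inner_smul_right]
    push_cast
    ring

theorem eLpNorm_two_sq {F : Type*} [NormedAddCommGroup F] (f : ℝ → F) (ν : Measure ℝ) :
    eLpNorm f 2 ν ^ 2 = ∫⁻ t, ‖f t‖ₑ ^ 2 ∂ν := by
  have h := eLpNorm_nnreal_pow_eq_lintegral (f := f) (μ := ν) (p := 2) (by norm_num)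
  simpa only [ENNReal.coe_ofNat, NNReal.coe_ofNat, ENNReal.rpow_two] using h

theorem eLpNorm_two_sq_eq_ofReal {F : Type*} [NormedAddCommGroup F] {f : ℝ → F} {ν : Measure ℝ}
    (hf : MemLp f 2 ν) : eLpNorm f 2 ν ^ 2 = ENNReal.ofReal (∫ t, ‖f t‖ ^ 2 ∂ν) := by
  rw [ofReal_integral_eq_lintegral_ofReal (integrable_norm_sq_of_memLp hf)
    (.of_forall fun t => by positivity)]
  rw [eLpNorm_two_sq]
  refine lintegral_congr fun t => ?_
  rw [ENNReal.ofReal_pow (norm_nonneg _), ofReal_norm]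

/-- Monotone convergence. It is needed because the solution is square integrable a priori only up to
finite times, while the bound is uniform in `T`. -/
theorem eLpNorm_two_sq_le_of_Iio {F : Type*} [NormedAddCommGroup F] {f : ℝ → F}
    (hf : ∀ T, MemLp f 2 (volume.restrict (Iio T))) {R : ℝ}
    (hR : ∀ T, ∫ t in Iio T, ‖f t‖ ^ 2 ≤ R) : eLpNorm f 2 volume ^ 2 ≤ ENNReal.ofReal R := by
  have hu : (⋃ n : ℕ, Iio (n : ℝ)) = univ := by
    refine eq_univ_of_forall fun x => ?_
    obtain ⟨n, hn⟩ := exists_nat_gt x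
    exact mem_iUnion.2 ⟨n, hn⟩
  rw [eLpNorm_two_sq, ← setLIntegral_univ, ← hu, setLIntegral_iUnion_of_directed]
  · refine iSup_le fun n => ?_
    rw [← eLpNorm_two_sq, eLpNorm_two_sq_eq_ofReal (hf n)]
    exact ENNReal.ofReal_le_ofReal (hR n)
  · exact directed_of_isDirected_le fun m n hmn => Iio_subset_Iio (by exact_mod_cast hmn)

theorem eLpNorm_top_sq_le {F : Type*} [NormedAddCommGroup F] {f : ℝ → F} {R : ℝ}
    (hR0 : 0 ≤ R) (hR : ∀ᵐ t : ℝ, ‖f t‖ ^ 2 ≤ R) :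
    eLpNorm f ∞ volume ^ 2 ≤ ENNReal.ofReal R := by
  have h : eLpNorm f ∞ volume ≤ ENNReal.ofReal (Real.sqrt R) := by
    rw [eLpNorm_exponent_top]
    refine eLpNormEssSup_le_of_ae_bound ?_
    filter_upwards [hR] with t ht
    exact Real.le_sqrt_of_sq_le ht
  calc eLpNorm f ∞ volume ^ 2 ≤ ENNReal.ofReal (Real.sqrt R) ^ 2 := by gcongr
    _ = ENNReal.ofReal R := by
        rw [← ENNReal.ofReal_pow (Real.sqrt_nonneg _), Real.sq_sqrt hR0]

end Main

end

theorem mainTheorem3 :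
    ∃ C : ℝ, 0 < C ∧
      ∀ (μ : ℝ), 0 < μ → ∀ (k : ℤ) (g₁ g₂ θ : ℝ → ℝ → ℂ),
        MemLp (Function.uncurry g₁) 2 (timeMeasure.prod channelMeasure) →
        MemLp (Function.uncurry g₂) 2 (timeMeasure.prod channelMeasure) →
        IsThetaISolution μ k g₁ g₂ θ →
        ENNReal.ofReal ((μ * (k : ℝ) ^ 2) ^ (1 / 3 : ℝ)) * mixedNorm 2 2 θ ^ 2
            + mixedNorm ∞ 2 θ ^ 2
          ≤ ENNReal.ofReal C *
            (ENNReal.ofReal (μ ^ (-1 / 3 : ℝ) * |(k : ℝ)| ^ (4 / 3 : ℝ)) * mixedNorm 2 2 g₁ ^ 2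
              + ENNReal.ofReal μ⁻¹ * mixedNorm 2 2 g₂ ^ 2) := by
  -- `4000` is `2000` for each of the two norms on the left.
  refine ⟨4000, by norm_num, fun μ hμ k g₁ g₂ θ hg₁ hg₂ hθ => ?_⟩
  obtain ⟨aθ, dθ, H⟩ := isShearEvolution_of_isThetaISolution hg₁ hg₂ hθ
  have ag₁ := ae_memLp_slice_of_local fun T _ => memLp_local_of_memLp hg₁ T
  have ag₂ := ae_memLp_slice_of_local fun T _ => memLp_local_of_memLp hg₂ T
  have L₁ := memLp_sliceCurve_of_memLp hg₁
  have L₂ := memLp_sliceCurve_of_memLp hg₂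
  simp only [mixedNorm_eq_eLpNorm_sliceCurve aθ, mixedNorm_eq_eLpNorm_sliceCurve ag₁,
    mixedNorm_eq_eLpNorm_sliceCurve ag₂, eLpNorm_two_sq_eq_ofReal L₁, eLpNorm_two_sq_eq_ofReal L₂]
  have b₁ : ∀ T, ∫ t in Iio T, ‖sliceCurve g₁ t‖ ^ 2 ≤ ∫ t, ‖sliceCurve g₁ t‖ ^ 2 := fun T =>
    setIntegral_le_integral (integrable_norm_sq_of_memLp L₁) (.of_forall fun t => by positivity)
  have b₂ : ∀ T, ∫ t in Iio T, ‖sliceCurve g₂ t‖ ^ 2 ≤ ∫ t, ‖sliceCurve g₂ t‖ ^ 2 := fun T =>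
    setIntegral_le_integral (integrable_norm_sq_of_memLp L₂) (.of_forall fun t => by positivity)
  set G₁ := ∫ t, ‖sliceCurve g₁ t‖ ^ 2 with hG₁
  set G₂ := ∫ t, ‖sliceCurve g₂ t‖ ^ 2 with hG₂
  have G₁0 : 0 ≤ G₁ := integral_nonneg fun t => by positivity
  have G₂0 : 0 ≤ G₂ := integral_nonneg fun t => by positivity
  set c : ℝ := μ ^ (-1 / 3 : ℝ) * |(k : ℝ)| ^ (4 / 3 : ℝ) with hc
  have hc0 : 0 ≤ c := by positivity
  rw [← ENNReal.ofReal_mul hc0, ← ENNReal.ofReal_mul (by positivity),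
    ← ENNReal.ofReal_add (by positivity) (by positivity), ← ENNReal.ofReal_mul (by norm_num)]
  -- For `k = 0` the weight of the `L²L²` norm is `0`, and its product with that norm is `0` in `[0,
  -- ∞]` even if the norm is infinite; only the supremum bound remains.
  rcases eq_or_ne k 0 with rfl | hk
  · have hE := IsShearEvolution.estimate_zero isSelfAdjoint_coordMul (by simpa using H) hμ
    have h0 : (μ * (((0 : ℤ) : ℝ)) ^ 2) ^ (1 / 3 : ℝ) = 0 := by
      norm_num
    rw [h0, ENNReal.ofReal_zero, zero_mul, zero_add]
    refine eLpNorm_top_sq_le (by positivity) ?_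
    filter_upwards [hE] with t ht
    have h1 := mul_le_mul_of_nonneg_left (b₂ t) (inv_nonneg.2 hμ.le)
    have h2 : 0 ≤ c * G₁ := by positivity
    have h3 : 0 ≤ μ⁻¹ * G₂ := by positivity
    linarith
  · have hk' : (k : ℝ) ≠ 0 := by exact_mod_cast hk
    have hpos : 0 < μ * (k : ℝ) ^ 2 := by positivity
    set τ : ℝ := (μ * (k : ℝ) ^ 2) ^ (-1 / 3 : ℝ) with hτdef
    have hτ : 0 < τ := Real.rpow_pos_of_pos hpos _
    have hinv : (μ * (k : ℝ) ^ 2) ^ (1 / 3 : ℝ) = τ⁻¹ := by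
      rw [hτdef, ← Real.rpow_neg hpos.le]; norm_num
    have hscale : μ * (k : ℝ) ^ 2 * τ ^ 3 = 1 := by
      have h3 : τ ^ 3 = (μ * (k : ℝ) ^ 2)⁻¹ := by
        rw [hτdef, ← Real.rpow_natCast, ← Real.rpow_mul hpos.le, ← Real.rpow_neg_one]
        norm_num
      rw [h3, mul_inv_cancel₀ hpos.ne']
    -- The weight `τ k²` produced by the abstract estimate is exactly `μ^(-1/3) |k|^(4/3)`.
    have hcτ : τ * (k : ℝ) ^ 2 = c := by
      have ha : 0 < |(k : ℝ)| := abs_pos.2 hk'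
      rw [hτdef, hc, ← sq_abs, Real.mul_rpow hμ.le (by positivity), ← Real.rpow_natCast,
        ← Real.rpow_mul ha.le, mul_assoc, ← Real.rpow_add ha]
      norm_num
    obtain ⟨E1, E2⟩ := H.estimate isClosed_h10Graph isSelfAdjoint_coordMul coordMul_mem_h10Graph
      h10Graph_parts hμ hk' hτ hscale
    have hR : ∀ T, 2000 * (τ * (k : ℝ) ^ 2 * (∫ t in Iio T, ‖sliceCurve g₁ t‖ ^ 2)
        + μ⁻¹ * ∫ t in Iio T, ‖sliceCurve g₂ t‖ ^ 2) ≤ 2000 * (c * G₁ + μ⁻¹ * G₂) := by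
      intro T
      rw [hcτ]
      have := b₁ T
      have := b₂ T
      gcongr
    have hRpos : 0 ≤ 2000 * (c * G₁ + μ⁻¹ * G₂) := by positivity
    have first := eLpNorm_two_sq_le_of_Iio H.isWeakEvolution.memLp_sol
      (R := τ * (2000 * (c * G₁ + μ⁻¹ * G₂))) fun T => by
        have := (E1 T).trans (hR T)
        rwa [inv_mul_le_iff₀ hτ] at this
    have second := eLpNorm_top_sq_le hRpos (E2.mono fun t ht => ht.trans (hR t))
    rw [hinv]
    calc ENNReal.ofReal τ⁻¹ * eLpNorm (sliceCurve θ) 2 volume ^ 2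
          + eLpNorm (sliceCurve θ) ∞ volume ^ 2
        ≤ ENNReal.ofReal τ⁻¹ * ENNReal.ofReal (τ * (2000 * (c * G₁ + μ⁻¹ * G₂)))
          + ENNReal.ofReal (2000 * (c * G₁ + μ⁻¹ * G₂)) := by gcongr
      _ = ENNReal.ofReal (4000 * (c * G₁ + μ⁻¹ * G₂)) := by
          rw [← ENNReal.ofReal_mul (by positivity), inv_mul_cancel_left₀ hτ.ne',
            ← ENNReal.ofReal_add hRpos hRpos]
          congr 1
          ring
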